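/- Let $(C,\otimes,\mathbf 1)$ be a closed symmetric monoidal category with all (small) limits and colimits. Let $Comm(C)$ be the category of commutative monoids in $C$ and $Aff_C=Comm(C)^{op}$; write $\mathrm{Spec}\,A$ for the object of $Aff_C$ given by $A$. A morphism $\mathrm{Spec}\,B\to\mathrm{Spec}\,A$ is flat if $-\otimes_A B\colon A\text{-}Mod\to B\text{-}Mod$ commutes with finite limits; it is a Zariski open if moreover $A\to B$ is an epimorphism in $Comm(C)$ and is of finite presentation, i.e. $\mathrm{Hom}_{A/Comm(C)}(B,-)$ commutes with filtered colimits. A family $\{\mathrm{Spec}\,A_i\to \mathrm{Spec}\,A\}_{i\in I}$ of Zariski opens is a Zariski covering if there is a finite $J\subset I$ such that the functors $-\otimes_A A_j$, $j\in J$, jointly reflect isomorphisms of $A$-modules. Let $Sh(Aff_C)$ be the category of sheaves of sets on $Aff_C$ for the topology generated by the Zariski coverings (with sets, and index sets of families of sheaves, in a universe for which $Aff_C$ is small). Sheaves isomorphic to a representable presheaf $\mathrm{Hom}(-,\mathrm{Spec}\,A)$ are called affine schemes. A subsheaf of an affine scheme $X$ is a Zariski open of $X$ if it is the image of $\coprod_{i}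 X_i\to X$ for some (possibly infinite) family of Zariski opens $X_i\to X$ in $Aff_C$. A morphism $F\to G$ of sheaves is a Zariski open if for every affine scheme $X$ and every $X\to G$, the projection $F\times_G X\to X$ is a monomorphism whose image is a Zariski open of $X$. A sheaf $F$ is a scheme (relative to $C$) if there are affine schemes $X_i$ and Zariski opens $X_i\to F$, $i \in I$, such that $\coprod_i X_i\to F$ is an epimorphism of sheaves. $Sch(C)\subset Sh(Aff_C)$ is the full subcategory of schemes. Then: 1. $Sch(C)$ is stable in $Sh(Aff_C)$ under disjoint unions (coproducts of arbitrary families) and under fibre products. 2. A sheaf $F\in Sh(Aff_C)$ is a scheme if and only if there exist a sheaf $X$ and an equivalence relation $R\subset X\times X$ in $Sh(Aff_C)$ such that: (a) $X\simeq\coprod_{i\in I}U_i$ with the $U_i$ affine schemes; (b) for all $(i,j)\in I^2$, if $R_{i,j}\subset U_i\times U_j$ denotes the inverse image of $R$ under $U_i\times U_j\to X\times X$, the induced morphism $R_{i,j}\to U_i$ is a Zariski open; (c) for all $i\in I$, the subobject $R_{i,i}\subset U_i\times U_i$ is the image of the diagonal $U_i\to U_i\times U_i$; (d) $F$ is isomorphic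 to the quotient sheaf $X/R$. -/

import Mathlib

open CategoryTheory MonoidalCategory MonObj Limits Opposite

universe v u

namespace RelSch

section BaseChange

set_option linter.unusedSectionVars false

variable {C : Type u} [Category.{v} C] [MonoidalCategory C] [MonoidalClosed C] [HasColimits C]
  {A B : C} [MonObj A] [MonObj B] (f : A ⟶ B) [IsMonHom f]

/-- The object `B ⊗_A M`: the coequalizer of `B ⊗ (A ⊗ M) ⇉ B ⊗ M` given by the action of `A` on `B`
(through `f`) and on `M`. -/
noncomputable def tensorObj (M : Mod C A) : C :=
  coequalizer ((α_ B A M.X).inv ≫ (B ◁ f ≫ μ[B]) ▷ M.X) (B ◁ ModObj.smul (M := A) (X := M.X))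

/-- The projection `B ⊗ M ⟶ B ⊗_A M`. -/
noncomputable def tensorπ (M : Mod C A) : B ⊗ M.X ⟶ tensorObj f M :=
  coequalizer.π _ _

instance (M : Mod C A) : Epi (tensorπ f M) :=
  inferInstanceAs (Epi (coequalizer.π _ _))

instance (M : Mod C A) (X : C) : Epi (X ◁ tensorπ f M) :=
  inferInstanceAs (Epi ((tensorLeft X).map (tensorπ f M)))

lemma tensor_condition (M : Mod C A) :
    B ◁ f ▷ M.X ≫ (α_ B B M.X).inv ≫ μ[B] ▷ M.X ≫ tensorπ f M =
      B ◁ ModObj.smul (M := A) (X := M.X) ≫ tensorπ f M := by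
  have : ((α_ B A M.X).inv ≫ (B ◁ f ≫ μ[B]) ▷ M.X) ≫ tensorπ f M =
      B ◁ ModObj.smul (M := A) (X := M.X) ≫ tensorπ f M := coequalizer.condition _ _
  rw [comp_whiskerRight, Category.assoc, Category.assoc,
    ← associator_inv_naturality_middle_assoc] at this
  exact this

lemma mul_free_assoc (X : C) :
    B ◁ (α_ B B X).inv ≫ B ◁ μ[B] ▷ X ≫ (α_ B B X).inv ≫ μ[B] ▷ X =
      (α_ B B (B ⊗ X)).inv ≫ μ[B] ▷ (B ⊗ X) ≫ (α_ B B X).inv ≫ μ[B] ▷ X := by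
  rw [associator_inv_naturality_middle_assoc, ← comp_whiskerRight,
    associator_inv_naturality_left_assoc, ← comp_whiskerRight, MonObj.mul_assoc]
  simp

lemma one_free_left (X : C) :
    (λ_ (B ⊗ X)).inv ≫ η[B] ▷ (B ⊗ X) ≫ (α_ B B X).inv ≫ μ[B] ▷ X = 𝟙 _ := by
  rw [associator_inv_naturality_left_assoc, ← comp_whiskerRight, MonObj.one_mul]
  simp

lemma one_free_right (X : C) :
    B ◁ (λ_ X).inv ≫ B ◁ η[B] ▷ X ≫ (α_ B B X).inv ≫ μ[B] ▷ X = 𝟙 _ := by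
  rw [associator_inv_naturality_middle_assoc, ← comp_whiskerRight, MonObj.mul_one]
  simp

lemma tensor_act_aux (M : Mod C A) :
    B ◁ ((α_ B A M.X).inv ≫ (B ◁ f ≫ μ[B]) ▷ M.X) ≫ (α_ B B M.X).inv ≫ μ[B] ▷ M.X ≫ tensorπ f M =
      B ◁ B ◁ ModObj.smul (M := A) (X := M.X) ≫
        (α_ B B M.X).inv ≫ μ[B] ▷ M.X ≫ tensorπ f M := by
  rw [associator_inv_naturality_right_assoc, whisker_exchange_assoc, ← tensor_condition,
    ← whisker_exchange_assoc, ← associator_inv_naturality_right_assoc,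
    comp_whiskerRight, ← associator_inv_naturality_middle_assoc,
    MonoidalCategory.whiskerLeft_comp, MonoidalCategory.whiskerLeft_comp]
  have := mul_free_assoc (B := B) M.X =≫ tensorπ f M
  simp only [Category.assoc] at this ⊢
  rw [this]

/-- The action of `B` on `B ⊗_A M`. -/
noncomputable def tensorAct (M : Mod C A) : B ⊗ tensorObj f M ⟶ tensorObj f M :=
  (PreservesCoequalizer.iso (tensorLeft B) _ _).inv ≫
    coequalizer.desc ((α_ B B M.X).inv ≫ μ[B] ▷ M.X ≫ tensorπ f M) (tensor_act_aux f M)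

lemma tensorπ_act (M : Mod C A) :
    B ◁ tensorπ f M ≫ tensorAct f M = (α_ B B M.X).inv ≫ μ[B] ▷ M.X ≫ tensorπ f M :=
  map_π_preserves_coequalizer_inv_desc (tensorLeft B) _ _ _ (tensor_act_aux f M)

/-- The `B`-module `B ⊗_A M`. -/
noncomputable def tensorMod (M : Mod C A) : Mod C B where
  X := tensorObj f M
  mod :=
    { smul := tensorAct f M
      one_smul := by
        change η[B] ▷ tensorObj f M ≫ tensorAct f M = (λ_ _).hom
        rw [← cancel_epi (_ ◁ tensorπ f M), whisker_exchange_assoc, tensorπ_act,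
          associator_inv_naturality_left_assoc, ← comp_whiskerRight_assoc, MonObj.one_mul,
          leftUnitor_naturality]
        simp
      mul_smul := by
        change μ[B] ▷ tensorObj f M ≫ tensorAct f M =
          (α_ B B _).hom ≫ B ◁ tensorAct f M ≫ tensorAct f M
        rw [← cancel_epi (_ ◁ tensorπ f M), whisker_exchange_assoc, tensorπ_act,
          associator_naturality_right_assoc, ← MonoidalCategory.whiskerLeft_comp_assoc, tensorπ_act,
          MonoidalCategory.whiskerLeft_comp_assoc, MonoidalCategory.whiskerLeft_comp_assoc,
          tensorπ_act]
        have := mul_free_assoc (B := B) M.X =≫ tensorπ f M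
        simp only [Category.assoc] at this
        rw [this]
        simp }

/-- The canonical map `M ⟶ B ⊗_A M`. -/
noncomputable def tensorUnit (M : Mod C A) : M.X ⟶ tensorObj f M :=
  (λ_ M.X).inv ≫ η[B] ▷ M.X ≫ tensorπ f M

lemma smul_tensorUnit (M : Mod C A) :
    ModObj.smul (M := A) (X := M.X) ≫ tensorUnit f M = f ▷ M.X ≫ tensorπ f M := by
  have h := one_free_left (B := B) M.X =≫ tensorπ f M
  simp only [Category.assoc, Category.id_comp] at h
  unfold tensorUnit
  rw [leftUnitor_inv_naturality_assoc]
  change _ ≫ (𝟙_ C) ◁ ModObj.smul (M := A) (X := M.X) ≫ _ = _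
  rw [whisker_exchange_assoc, ← tensor_condition, ← whisker_exchange_assoc,
    ← leftUnitor_inv_naturality_assoc, h]

lemma whiskerLeft_tensorUnit_act (M : Mod C A) :
    B ◁ tensorUnit f M ≫ tensorAct f M = tensorπ f M := by
  have h := one_free_right (B := B) M.X =≫ tensorπ f M
  simp only [Category.assoc, Category.id_comp] at h
  simp only [tensorUnit, MonoidalCategory.whiskerLeft_comp, Category.assoc, tensorπ_act, h]

lemma free_smul {X : C} (N : Mod C B) (h : X ⟶ N.X) :
    (α_ B B X).inv ≫ μ[B] ▷ X ≫ B ◁ h ≫ ModObj.smul (M := B) (X := N.X) =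
      B ◁ (B ◁ h ≫ ModObj.smul (M := B) (X := N.X)) ≫ ModObj.smul (M := B) (X := N.X) := by
  rw [← whisker_exchange_assoc, ModObj.mul_smul_self,
    ← associator_inv_naturality_right_assoc]
  simp

lemma desc_condition (M : Mod C A) (N : Mod C B) (k : M.X ⟶ N.X)
    (hk : ModObj.smul (M := A) (X := M.X) ≫ k =
      A ◁ k ≫ f ▷ N.X ≫ ModObj.smul (M := B) (X := N.X)) :
    ((α_ B A M.X).inv ≫ (B ◁ f ≫ μ[B]) ▷ M.X) ≫ B ◁ k ≫ ModObj.smul (M := B) (X := N.X) =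
      B ◁ ModObj.smul (M := A) (X := M.X) ≫ B ◁ k ≫ ModObj.smul (M := B) (X := N.X) := by
  have h := free_smul N k
  have h' : B ◁ ModObj.smul (M := A) (X := M.X) ≫ B ◁ k =
      B ◁ (f ▷ M.X) ≫ B ◁ (B ◁ k ≫ ModObj.smul (M := B) (X := N.X)) := by
    rw [← MonoidalCategory.whiskerLeft_comp, ← MonoidalCategory.whiskerLeft_comp, hk,
      whisker_exchange_assoc]
  have h'' := h' =≫ ModObj.smul (M := B) (X := N.X)
  simp only [Category.assoc] at h''
  refine Eq.trans ?_ h''.symm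
  rw [← h, comp_whiskerRight, Category.assoc, Category.assoc,
    ← associator_inv_naturality_middle_assoc]

/-- The map `B ⊗_A M ⟶ N` induced by an `A`-linear map `M ⟶ N`. -/
noncomputable def tensorDesc (M : Mod C A) (N : Mod C B) (k : M.X ⟶ N.X)
    (hk : ModObj.smul (M := A) (X := M.X) ≫ k =
      A ◁ k ≫ f ▷ N.X ≫ ModObj.smul (M := B) (X := N.X)) : tensorObj f M ⟶ N.X :=
  coequalizer.desc (B ◁ k ≫ ModObj.smul (M := B) (X := N.X)) (desc_condition f M N k hk)

lemma tensorπ_desc (M : Mod C A) (N : Mod C B) (k : M.X ⟶ N.X)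
    (hk : ModObj.smul (M := A) (X := M.X) ≫ k =
      A ◁ k ≫ f ▷ N.X ≫ ModObj.smul (M := B) (X := N.X)) :
    tensorπ f M ≫ tensorDesc f M N k hk = B ◁ k ≫ ModObj.smul (M := B) (X := N.X) :=
  coequalizer.π_desc _ _

lemma tensorAct_desc (M : Mod C A) (N : Mod C B) (k : M.X ⟶ N.X)
    (hk : ModObj.smul (M := A) (X := M.X) ≫ k =
      A ◁ k ≫ f ▷ N.X ≫ ModObj.smul (M := B) (X := N.X)) :
    tensorAct f M ≫ tensorDesc f M N k hk =
      B ◁ tensorDesc f M N k hk ≫ ModObj.smul (M := B) (X := N.X) := by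
  have h1 : B ◁ tensorπ f M ≫ B ◁ tensorDesc f M N k hk =
      B ◁ (B ◁ k ≫ ModObj.smul (M := B) (X := N.X)) := by
    rw [← MonoidalCategory.whiskerLeft_comp, tensorπ_desc]
  have h2 := h1 =≫ ModObj.smul (M := B) (X := N.X)
  rw [← cancel_epi (B ◁ tensorπ f M), ← Category.assoc, tensorπ_act]
  simp only [Category.assoc] at h2 ⊢
  rw [h2, tensorπ_desc, free_smul]

lemma tensorUnit_desc (M : Mod C A) (N : Mod C B) (k : M.X ⟶ N.X)
    (hk : ModObj.smul (M := A) (X := M.X) ≫ k =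
      A ◁ k ≫ f ▷ N.X ≫ ModObj.smul (M := B) (X := N.X)) :
    tensorUnit f M ≫ tensorDesc f M N k hk = k := by
  unfold tensorUnit
  simp only [Category.assoc]
  rw [tensorπ_desc, ← whisker_exchange_assoc, ModObj.one_smul_self]
  simp

lemma tensorUnit_linear (M : Mod C A) (N : Mod C B) (g : tensorObj f M ⟶ N.X)
    (hg : tensorAct f M ≫ g = B ◁ g ≫ ModObj.smul (M := B) (X := N.X)) :
    ModObj.smul (M := A) (X := M.X) ≫ tensorUnit f M ≫ g =
      A ◁ (tensorUnit f M ≫ g) ≫ f ▷ N.X ≫ ModObj.smul (M := B) (X := N.X) := by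
  have h := whiskerLeft_tensorUnit_act f M =≫ g
  have h' := smul_tensorUnit f M =≫ g
  simp only [Category.assoc] at h h'
  refine h'.trans ?_
  rw [whisker_exchange_assoc, MonoidalCategory.whiskerLeft_comp, Category.assoc, ← hg, h]

lemma tensorDesc_unit (M : Mod C A) (N : Mod C B) (g : tensorObj f M ⟶ N.X)
    (hg : tensorAct f M ≫ g = B ◁ g ≫ ModObj.smul (M := B) (X := N.X)) :
    tensorDesc f M N (tensorUnit f M ≫ g) (tensorUnit_linear f M N g hg) = g := by
  have h := whiskerLeft_tensorUnit_act f M =≫ g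
  rw [← cancel_epi (tensorπ f M), tensorπ_desc, MonoidalCategory.whiskerLeft_comp,
    Category.assoc, ← hg, ← h, Category.assoc]

/-- `B`-linear maps `B ⊗_A M ⟶ N` are `A`-linear maps `M ⟶ N`. -/
noncomputable def tensorHomEquiv (M : Mod C A) (N : Mod C B) :
    (tensorMod f M ⟶ N) ≃ (M ⟶ (Mod.comap f).obj N) where
  toFun g := Mod.Hom.mk' (M := M) (N := (Mod.comap f).obj N)
    (tensorUnit f M ≫ (g.hom : tensorObj f M ⟶ N.X))
    (tensorUnit_linear f M N g.hom g.isModHom.smul_hom)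
  invFun h := Mod.Hom.mk' (M := tensorMod f M) (N := N)
    (tensorDesc f M N h.hom h.isModHom.smul_hom)
    (tensorAct_desc f M N h.hom h.isModHom.smul_hom)
  left_inv g := by
    ext
    exact tensorDesc_unit f M N g.hom g.isModHom.smul_hom
  right_inv h := by
    ext
    exact tensorUnit_desc f M N h.hom h.isModHom.smul_hom

/-- The base change functor `- ⊗_A B` from `A`-modules to `B`-modules. -/
noncomputable def baseChange : Mod C A ⥤ Mod C B :=
  Adjunction.leftAdjointOfEquiv (G := Mod.comap f) (tensorHomEquiv f) (by
   intros; ext; exact (Category.assoc _ _ _).symm)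

/-- Base change is left adjoint to restriction of scalars. -/
noncomputable def baseChangeAdj : baseChange f ⊣ Mod.comap (D := C) f :=
  Adjunction.adjunctionOfEquivLeft _ _

end BaseChange

section Affine

variable (C : Type u) [Category.{v} C] [MonoidalCategory C] [SymmetricCategory C]

/-- The category of affine schemes over `C`: the opposite of the category of commutative monoids
in `C`. -/
abbrev Aff : Type (max u v) := (CommMon C)ᵒᵖ

variable {C} [MonoidalClosed C] [HasColimits C]

instance {A B : CommMon C} (f : A ⟶ B) : IsMonHom (M := A.X) (N := B.X) f.hom.hom :=
  f.hom.isMonHom_hom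

/-- The functor `- ⊗_A B` attached to a morphism `f : Spec B ⟶ Spec A`. -/
noncomputable abbrev pullbackModules {Y X : Aff C} (f : Y ⟶ X) :
    Mod C X.unop.X ⥤ Mod C Y.unop.X :=
  baseChange (A := X.unop.X) (B := Y.unop.X) f.unop.hom.hom

/-- `f` is flat if `- ⊗_A B` is exact, i.e. commutes with finite limits. -/
def IsFlat {Y X : Aff C} (f : Y ⟶ X) : Prop :=
  PreservesFiniteLimits (pullbackModules f)

/-- A Zariski open of affine schemes: `A ⟶ B` is a flat epimorphism of finite presentation in the
category of commutative monoids, finite presentation meaning that `Hom_A(B, -)` commutes with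
filtered colimits of commutative `A`-algebras. -/
structure IsAffineOpen {Y X : Aff C} (f : Y ⟶ X) : Prop where
  epi : Epi f.unop
  flat : IsFlat f
  finitePresentation : MorphismProperty.isFinitelyPresentable.{v} (CommMon C) f.unop

/-- A flat (fpqc) covering family of an affine scheme. -/
structure IsFlatCover {I : Type*} {X : Aff C} {Y : I → Aff C} (f : ∀ i, Y i ⟶ X) : Prop where
  flat : ∀ i, IsFlat (f i)
  conservative : ∃ J : Finset I, ∀ ⦃M N : Mod C X.unop.X⦄ (g : M ⟶ N),
    (∀ j ∈ J, IsIso ((pullbackModules (f j)).map g)) → IsIso g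

/-- A Zariski covering family of an affine scheme. -/
structure IsZariskiCover {I : Type*} {X : Aff C} {Y : I → Aff C} (f : ∀ i, Y i ⟶ X) : Prop where
  flatCover : IsFlatCover f
  isOpen : ∀ i, IsAffineOpen (f i)

variable (C)

/-- The Zariski covering families, as collections of arrows. -/
def zariskiPrecoverage : Precoverage (Aff C) where
  coverings X := { R | ∃ (I : Type (max u v)) (Y : I → Aff C) (f : ∀ i, Y i ⟶ X),
    IsZariskiCover f ∧ R = Presieve.ofArrows Y f }

/-- The Zariski topology: the Grothendieck topology generated by the Zariski covering families. -/
def zariskiTopology : GrothendieckTopology (Aff C) :=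
  (zariskiPrecoverage C).toGrothendieck

/-- Sheaves of sets on the category of affine schemes for the Zariski topology; the sets live in
a universe for which the category of affine schemes is small. -/
abbrev Sh : Type _ := Sheaf (zariskiTopology C) (Type (max u v))

noncomputable instance : HasSheafify (zariskiTopology C) (Type (max u v)) :=
  inferInstanceAs (HasSheafify.{v, max u v, max u v, max u v + 1} _ (Type (max u v)))

instance : HasColimitsOfSize.{max u v, max u v} (Sh C) :=
  ⟨fun _ _ => Sheaf.instHasColimitsOfShape⟩

variable {C}

/-- A sheaf is an affine scheme if it is isomorphic to a representable one. -/
def IsAffine (X : Sh C) : Prop :=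
  ∃ A : Aff C, Nonempty (uliftYoneda.{u}.obj A ≅ X.obj)

/-- A morphism of sheaves is a Zariski open of affine schemes if it is isomorphic to the image of
such a morphism under the Yoneda embedding. -/
def IsAffineOpenMap {Y X : Sh C} (g : Y ⟶ X) : Prop :=
  ∃ (B A : Aff C) (f : B ⟶ A), IsAffineOpen f ∧
    Nonempty (Arrow.mk (uliftYoneda.{u}.map f) ≅ Arrow.mk g.hom)

/-- A subsheaf of an affine scheme is a Zariski open if it is the image of the coproduct of a
(possibly infinite) family of Zariski opens of affine schemes. -/
def IsZariskiOpenSub {X : Sh C} (F : Subobject X) : Prop :=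
  ∃ (I : Type (max u v)) (Y : I → Sh C) (g : ∀ i, Y i ⟶ X),
    (∀ i, IsAffineOpenMap (g i)) ∧ F = imageSubobject (Limits.Sigma.desc g)

/-- A morphism of sheaves `F ⟶ G` is a Zariski open (immersion) if for every affine scheme `X` and
every `X ⟶ G` the projection `F ×_G X ⟶ X` is a monomorphism whose image is a Zariski open of `X`. -/
def IsZariskiOpen {F G : Sh C} (f : F ⟶ G) : Prop :=
  ∀ (X : Sh C), IsAffine X → ∀ x : X ⟶ G,
    Mono (pullback.snd f x) ∧ IsZariskiOpenSub (imageSubobject (pullback.snd f x))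

/-- A Zariski affine covering of a sheaf. -/
structure IsZariskiAffineCover {I : Type (max u v)} {F : Sh C} {X : I → Sh C}
    (p : ∀ i, X i ⟶ F) : Prop where
  isAffine : ∀ i, IsAffine (X i)
  epi : Epi (Limits.Sigma.desc p)
  isOpen : ∀ i, IsZariskiOpen (p i)

variable (C) in
/-- The property of being a scheme relative to `C`. -/
def isScheme : ObjectProperty (Sh C) := fun F =>
  ∃ (I : Type (max u v)) (X : I → Sh C) (p : ∀ i, X i ⟶ F), IsZariskiAffineCover p

variable (C) in
/-- The category `Sch(C)` of schemes relative to `C`, a full subcategory of `Sh C`. -/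
abbrev Sch : Type _ := (isScheme C).FullSubcategory

/-- For a subsheaf `R` of `X × X` and `u i : U i ⟶ X`, the subsheaf of `U i × U j` which is the
inverse image of `R`. -/
noncomputable def restrictRelation {X : Sh C} (R : Subobject (X ⨯ X)) {I : Type (max u v)}
    {U : I → Sh C} (u : ∀ i, U i ⟶ X) (i j : I) : Subobject (U i ⨯ U j) :=
  (Subobject.pullback (prod.map (u i) (u j))).obj R

/-- The conditions on a relation `R` on a sheaf `X`, with respect to an
isomorphism `e` from a coproduct of affine schemes `U i` to `X`. -/
structure IsGluingRelation {X : Sh C} (R : Subobject (X ⨯ X)) {I : Type (max u v)}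
    (U : I → Sh C) (e : ∐ U ≅ X) : Prop where
  equivalence : IsEquivalenceRelation (R.arrow ≫ prod.fst) (R.arrow ≫ prod.snd)
  isAffine : ∀ i, IsAffine (U i)
  isOpen : ∀ i j, IsZariskiOpen
    ((restrictRelation R (fun k => Limits.Sigma.ι U k ≫ e.hom) i j).arrow ≫ prod.fst)
  diagonal : ∀ i, restrictRelation R (fun k => Limits.Sigma.ι U k ≫ e.hom) i i =
    imageSubobject (diag (U i))

/-- The sheaf quotient `X / R`. -/
noncomputable def quotient {X : Sh C} (R : Subobject (X ⨯ X)) : Sh C :=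
  coequalizer (R.arrow ≫ prod.fst) (R.arrow ≫ prod.snd)

end Affine

end RelSch

namespace RelSch

section Coequalizers

set_option linter.unusedSectionVars false

variable {C : Type u} [Category.{v} C] [MonoidalCategory C] [SymmetricCategory C]
  [MonoidalClosed C] {S E Q T : C} {a b : S ⟶ E} {q : E ⟶ Q} {w : a ≫ q = b ≫ q}

instance epi_whiskerLeft (X : C) {Y Z : C} (f : Y ⟶ Z) [Epi f] : Epi (X ◁ f) :=
  inferInstanceAs (Epi ((tensorLeft X).map f))

instance epi_whiskerRight (X : C) {Y Z : C} (f : Y ⟶ Z) [Epi f] : Epi (f ▷ X) :=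
  inferInstanceAs (Epi ((tensorRight X).map f))

instance epi_tensorHom {X X' Y Y' : C} (f : X ⟶ X') (g : Y ⟶ Y') [Epi f] [Epi g] :
    Epi (f ⊗ₘ g) := by
  rw [MonoidalCategory.tensorHom_def]; infer_instance

lemma exists_whiskerLeft_desc (hq : IsColimit (Cofork.ofπ q w)) (X : C) (k : X ⊗ E ⟶ T)
    (h : X ◁ a ≫ k = X ◁ b ≫ k) : ∃ l : X ⊗ Q ⟶ T, X ◁ q ≫ l = k :=
  let d := Cofork.IsColimit.desc' (isColimitCoforkMapOfIsColimit (tensorLeft X) w hq) k h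
  ⟨d.1, d.2⟩

lemma exists_whiskerRight_desc (hq : IsColimit (Cofork.ofπ q w)) (X : C) (k : E ⊗ X ⟶ T)
    (h : a ▷ X ≫ k = b ▷ X ≫ k) : ∃ l : Q ⊗ X ⟶ T, q ▷ X ≫ l = k :=
  let d := Cofork.IsColimit.desc' (isColimitCoforkMapOfIsColimit (tensorRight X) w hq) k h
  ⟨d.1, d.2⟩

end Coequalizers

section QuotientMonoid

set_option linter.unusedSectionVars false

variable {C : Type u} [Category.{v} C] [MonoidalCategory C] [SymmetricCategory C]
  [MonoidalClosed C] {K E Q : C} [MonObj E] [IsCommMonObj E] {s t : K ⟶ E} {q : E ⟶ Q}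
  {w : (s ▷ E ≫ μ) ≫ q = (t ▷ E ≫ μ) ≫ q}

lemma whiskerRight_mul_mul (s : K ⟶ E) :
    (s ▷ E ≫ μ) ▷ E ≫ μ = (α_ _ _ _).hom ≫ K ◁ μ ≫ s ▷ E ≫ μ := by
  rw [whisker_exchange_assoc]
  simp

lemma whiskerLeft_mul_mul (s : K ⟶ E) :
    E ◁ (s ▷ E ≫ μ) ≫ μ =
      (α_ _ _ _).inv ≫ (β_ _ _).hom ▷ E ≫ (α_ _ _ _).hom ≫ K ◁ μ ≫ s ▷ E ≫ μ := by
  have h : E ◁ s ≫ μ = (β_ E K).hom ≫ s ▷ E ≫ μ := by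
    rw [← BraidedCategory.braiding_naturality_right_assoc, IsCommMonObj.mul_comm]
  rw [← whiskerRight_mul_mul, ← comp_whiskerRight_assoc, ← h, MonoidalCategory.whiskerLeft_comp,
    comp_whiskerRight, Category.assoc, Category.assoc, MonObj.mul_assoc]
  simp

lemma exists_quotient_mul (hq : IsColimit (Cofork.ofπ q w)) :
    ∃ m : Q ⊗ Q ⟶ Q, (q ⊗ₘ q) ≫ m = μ ≫ q := by
  have : Epi q := ⟨fun _ _ h ↦ Cofork.IsColimit.hom_ext hq h⟩
  obtain ⟨l, hl⟩ := exists_whiskerLeft_desc hq E (μ ≫ q) (by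
    have h := K ◁ μ ≫= w
    simp only [Category.assoc] at h
    have h1 := whiskerLeft_mul_mul s =≫ q
    have h2 := whiskerLeft_mul_mul t =≫ q
    simp only [Category.assoc] at h1 h2
    rw [h1, h2, h])
  obtain ⟨m, hm⟩ := exists_whiskerRight_desc hq Q l (by
    rw [← cancel_epi (_ ◁ q), whisker_exchange_assoc, whisker_exchange_assoc, hl]
    have h := K ◁ μ ≫= w
    simp only [Category.assoc] at h
    have h1 := whiskerRight_mul_mul s =≫ q
    have h2 := whiskerRight_mul_mul t =≫ q
    simp only [Category.assoc] at h1 h2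
    rw [h1, h2, h])
  exact ⟨m, by rw [tensorHom_def', Category.assoc, hm, hl]⟩

/-- The monoid structure on the quotient of a commutative monoid `E` by a pair of maps `K ⟶ E`. -/
@[reducible]
noncomputable def quotientMonObj (hq : IsColimit (Cofork.ofπ q w)) : MonObj Q :=
  have : Epi q := ⟨fun _ _ h ↦ Cofork.IsColimit.hom_ext hq h⟩
  have hm := (exists_quotient_mul hq).choose_spec
  { one := η ≫ q
    mul := (exists_quotient_mul hq).choose
    one_mul := by
      rw [← cancel_epi (_ ◁ q), comp_whiskerRight_assoc, whisker_exchange_assoc,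
        whisker_exchange_assoc, ← MonoidalCategory.whisker_exchange_assoc,
        ← MonoidalCategory.tensorHom_def'_assoc, hm, MonObj.one_mul_assoc, leftUnitor_naturality]
    mul_one := by
      rw [← cancel_epi (q ▷ _), MonoidalCategory.whiskerLeft_comp_assoc, ← whisker_exchange_assoc,
        ← whisker_exchange_assoc, ← MonoidalCategory.tensorHom_def'_assoc, hm,
        MonObj.mul_one_assoc, rightUnitor_naturality]
    mul_assoc := by
      rw [← cancel_epi ((q ⊗ₘ q) ⊗ₘ q), associator_naturality_assoc, ← tensorHom_id,
        ← id_tensorHom, tensorHom_comp_tensorHom_assoc, tensorHom_comp_tensorHom_assoc, hm,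
        Category.comp_id, ← whiskerRight_comp_tensorHom_assoc, ← whiskerLeft_comp_tensorHom_assoc,
        hm, MonObj.mul_assoc_assoc] }

lemma tensorHom_quotient_mul (hq : IsColimit (Cofork.ofπ q w)) :
    letI := quotientMonObj hq
    (q ⊗ₘ q) ≫ μ[Q] = μ[E] ≫ q :=
  (exists_quotient_mul hq).choose_spec

lemma isMonHom_quotient (hq : IsColimit (Cofork.ofπ q w)) :
    letI := quotientMonObj hq
    IsMonHom q :=
  letI := quotientMonObj hq
  { one_hom := rfl
    mul_hom := (tensorHom_quotient_mul hq).symm }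

lemma isCommMonObj_quotient (hq : IsColimit (Cofork.ofπ q w)) :
    letI := quotientMonObj hq
    IsCommMonObj Q :=
  letI := quotientMonObj hq
  have : Epi q := ⟨fun _ _ h ↦ Cofork.IsColimit.hom_ext hq h⟩
  { mul_comm := by
      rw [← cancel_epi (q ⊗ₘ q), BraidedCategory.braiding_naturality_assoc,
        tensorHom_quotient_mul hq, IsCommMonObj.mul_comm_assoc] }

/-- A morphism induced on a quotient of commutative monoids by a morphism of monoids is a
morphism of monoids. -/
lemma isMonHom_of_quotient [MonObj Q] [IsMonHom q] [Epi q] {D : C} [MonObj D] (l : Q ⟶ D)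
    [IsMonHom (q ≫ l)] : IsMonHom l where
  one_hom := by
    rw [← IsMonHom.one_hom q, Category.assoc, IsMonHom.one_hom (q ≫ l)]
  mul_hom := by
    rw [← cancel_epi (q ⊗ₘ q), ← IsMonHom.mul_hom_assoc, IsMonHom.mul_hom (q ≫ l),
      tensorHom_comp_tensorHom_assoc]

end QuotientMonoid

end RelSch

namespace RelSch

section Coproduct

set_option linter.unusedSectionVars false

variable {C : Type u} [Category.{v} C] [MonoidalCategory C] [SymmetricCategory C]
  {B D : C} [MonObj B] [MonObj D]

variable (B D) in
/-- The inclusion `B ⟶ B ⊗ D`. -/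
def tensorInl : B ⟶ B ⊗ D := (ρ_ B).inv ≫ B ◁ η

variable (B D) in
/-- The inclusion `D ⟶ B ⊗ D`. -/
def tensorInr : D ⟶ B ⊗ D := (λ_ D).inv ≫ η ▷ D

lemma tensorInl_whiskerRight_mul :
    tensorInl B D ▷ (B ⊗ D) ≫ μ = (α_ B B D).inv ≫ μ ▷ D := by
  have h : (ρ_ B).inv ▷ (B ⊗ D) ≫ tensorμ B (𝟙_ C) B D ≫ (B ⊗ B) ◁ (λ_ D).hom =
      (α_ B B D).inv := by
    simp only [tensorμ, braiding_tensorUnit_left]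
    monoidal
  rw [tensorInl, MonObj.tensorObj.mul_def, comp_whiskerRight_assoc, ← id_tensorHom,
    tensorμ_natural_left_assoc, tensorHom_comp_tensorHom, MonObj.one_mul, ← h]
  simp [MonoidalCategory.tensorHom_def']

lemma tensorInr_whiskerRight_mul :
    tensorInr B D ▷ (B ⊗ D) ≫ μ =
      (α_ D B D).inv ≫ (β_ D B).hom ▷ D ≫ (α_ B D D).hom ≫ B ◁ μ := by
  have h : (λ_ D).inv ▷ (B ⊗ D) ≫ tensorμ (𝟙_ C) D B D ≫ (λ_ B).hom ▷ (D ⊗ D) =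
      (α_ D B D).inv ≫ (β_ D B).hom ▷ D ≫ (α_ B D D).hom := by
    simp only [tensorμ]
    monoidal
  rw [tensorInr, MonObj.tensorObj.mul_def, comp_whiskerRight_assoc, ← tensorHom_id η,
    tensorμ_natural_left_assoc, tensorHom_comp_tensorHom, MonObj.one_mul, ← reassoc_of% h]
  simp [MonoidalCategory.tensorHom_def]

instance isMonHom_one : IsMonHom η[D] where
  mul_hom := by simp [unitors_equal]

instance : IsMonHom (tensorInl B D) :=
  have : IsMonHom ((ρ_ B).symm.hom) := inferInstanceAs (IsMonHom (ρ_ B).inv)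
  inferInstanceAs (IsMonHom ((ρ_ B).inv ≫ B ◁ η[D]))

instance : IsMonHom (tensorInr B D) :=
  inferInstanceAs (IsMonHom ((λ_ D).inv ≫ η[B] ▷ D))

lemma tensorInl_tensorHom_mul {T : C} [MonObj T] (b : B ⟶ T) (d : D ⟶ T) [IsMonHom d] :
    tensorInl B D ≫ (b ⊗ₘ d) ≫ μ = b := by
  simp only [tensorInl, Category.assoc, whiskerLeft_comp_tensorHom_assoc, IsMonHom.one_hom]
  rw [MonoidalCategory.tensorHom_def, Category.assoc, MonObj.mul_one]
  simp

lemma tensorInr_tensorHom_mul {T : C} [MonObj T] (b : B ⟶ T) (d : D ⟶ T) [IsMonHom b] :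
    tensorInr B D ≫ (b ⊗ₘ d) ≫ μ = d := by
  simp only [tensorInr, Category.assoc, whiskerRight_comp_tensorHom_assoc, IsMonHom.one_hom]
  rw [MonoidalCategory.tensorHom_def', Category.assoc, MonObj.one_mul]
  simp

lemma inl_tensorHom_inr_mul : (tensorInl B D ⊗ₘ tensorInr B D) ≫ μ = 𝟙 (B ⊗ D) := by
  rw [MonoidalCategory.tensorHom_def', Category.assoc, tensorInl_whiskerRight_mul, tensorInr,
    MonoidalCategory.whiskerLeft_comp, Category.assoc, associator_inv_naturality_middle_assoc,
    ← comp_whiskerRight, MonObj.mul_one]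
  simp

instance isMonHom_mul {T : C} [MonObj T] [IsCommMonObj T] : IsMonHom μ[T] where
  one_hom := by simp [MonObj.tensorObj.one_def, ← unitors_equal]
  mul_hom := by simp [MonObj.tensorObj.mul_def]

instance isMonHom_tensorHom_mul {T : C} [MonObj T] [IsCommMonObj T] (b : B ⟶ T) (d : D ⟶ T)
    [IsMonHom b] [IsMonHom d] : IsMonHom ((b ⊗ₘ d) ≫ μ) :=
  inferInstance

end Coproduct

end RelSch

namespace RelSch

section UnderlyingHom

variable {C : Type u} [Category.{v} C] [MonoidalCategory C] [SymmetricCategory C]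
  {A B D : CommMon C}

/-- The morphism in `C` underlying a morphism of commutative monoids. -/
def homX (f : A ⟶ B) : A.X ⟶ B.X := f.hom.hom

instance (f : A ⟶ B) : IsMonHom (homX f) := inferInstanceAs (IsMonHom (f.hom.hom))

/-- A morphism of commutative monoids from a morphism in `C`. -/
def ofHomX (f : A.X ⟶ B.X) [IsMonHom f] : A ⟶ B :=
  CommMon.homMk (Mon.ofHom f)

@[simp] lemma homX_ofHomX (f : A.X ⟶ B.X) [IsMonHom f] : homX (ofHomX f) = f := rfl

@[simp] lemma homX_comp (f : A ⟶ B) (g : B ⟶ D) : homX (f ≫ g) = homX f ≫ homX g := rfl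

@[simp] lemma homX_id : homX (𝟙 A) = 𝟙 A.X := rfl

lemma homX_injective {f g : A ⟶ B} (h : homX f = homX g) : f = g := CommMon.hom_ext _ _ h

end UnderlyingHom

section Pushout

set_option linter.unusedSectionVars false

variable {C : Type u} [Category.{v} C] [MonoidalCategory C] [SymmetricCategory C]
  [MonoidalClosed C] [HasColimits C]

section

variable {A B D : C} [MonObj A] [MonObj B] [MonObj D] [IsCommMonObj B]
  (f : A ⟶ B) (g : A ⟶ D) [IsMonHom f] [IsMonHom g]

/-- `D` as an `A`-module. -/
abbrev algMod : Mod C A := (Mod.comap g).obj (Mod.regular D)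

lemma inl_pair : (f ≫ tensorInl B D) ▷ (B ⊗ D) ≫ μ =
    ((α_ A B D).inv ≫ (β_ A B).hom ▷ D ≫ (α_ B A D).hom) ≫
      (α_ B A D).inv ≫ (B ◁ f ≫ μ) ▷ D := by
  rw [comp_whiskerRight_assoc, tensorInl_whiskerRight_mul]
  simp only [Category.assoc, Iso.hom_inv_id_assoc, ← comp_whiskerRight]
  rw [← BraidedCategory.braiding_naturality_left_assoc, IsCommMonObj.mul_comm]
  simp

lemma inr_pair : (g ≫ tensorInr B D) ▷ (B ⊗ D) ≫ μ =
    ((α_ A B D).inv ≫ (β_ A B).hom ▷ D ≫ (α_ B A D).hom) ≫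
      B ◁ (g ▷ D ≫ μ) := by
  rw [comp_whiskerRight_assoc, tensorInr_whiskerRight_mul]
  simp only [Category.assoc, MonoidalCategory.whiskerLeft_comp]
  rw [associator_inv_naturality_left_assoc, ← comp_whiskerRight_assoc,
    BraidedCategory.braiding_naturality_left]
  simp

lemma equalizes_iff {T : C} (k : B ⊗ D ⟶ T) :
    ((f ≫ tensorInl B D) ▷ (B ⊗ D) ≫ μ) ≫ k = ((g ≫ tensorInr B D) ▷ (B ⊗ D) ≫ μ) ≫ k ↔
      ((α_ B A D).inv ≫ (B ◁ f ≫ μ) ▷ D) ≫ k = B ◁ (g ▷ D ≫ μ) ≫ k := by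
  rw [inl_pair, inr_pair]
  simp only [Category.assoc, cancel_epi]

lemma tensorπ_algMod_condition : ((α_ B A D).inv ≫ (B ◁ f ≫ μ) ▷ D) ≫ tensorπ f (algMod g) =
    B ◁ (g ▷ D ≫ μ) ≫ tensorπ f (algMod g) :=
  coequalizer.condition ((α_ B A D).inv ≫ (B ◁ f ≫ μ) ▷ D) (B ◁ (g ▷ D ≫ μ))

lemma tensorπ_pair : ((f ≫ tensorInl B D) ▷ (B ⊗ D) ≫ μ) ≫ tensorπ f (algMod g) =
    ((g ≫ tensorInr B D) ▷ (B ⊗ D) ≫ μ) ≫ tensorπ f (algMod g) :=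
  (equalizes_iff f g _).2 (tensorπ_algMod_condition f g)

/-- The tensor product `B ⊗_A D` as a quotient of the commutative monoid `B ⊗ D`. -/
noncomputable def tensorπIsColimit : IsColimit (Cofork.ofπ _ (tensorπ_pair f g)) :=
  Cofork.IsColimit.mk' _ fun c ↦ by
    have h := (equalizes_iff f g c.π).1 c.condition
    exact ⟨coequalizer.desc c.π h, coequalizer.π_desc _ _, fun hm ↦
      (cancel_epi (tensorπ f (algMod g))).1 (hm.trans (coequalizer.π_desc _ _).symm)⟩

end

variable {A B D : CommMon C} (f : A ⟶ B) (g : A ⟶ D)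

/-- The tensor product `B ⊗_A D` of commutative monoids. -/
noncomputable def pushoutObj : CommMon C where
  X := tensorObj (homX f) (algMod (homX g))
  mon := quotientMonObj (tensorπIsColimit (homX f) (homX g))
  comm := isCommMonObj_quotient (tensorπIsColimit (homX f) (homX g))

/-- The projection `B ⊗ D ⟶ B ⊗_A D`. -/
noncomputable def pushoutπ : B.X ⊗ D.X ⟶ (pushoutObj f g).X := tensorπ (homX f) (algMod (homX g))

instance : Epi (pushoutπ f g) := inferInstanceAs (Epi (tensorπ _ _))

instance : IsMonHom (pushoutπ f g) :=
  isMonHom_quotient (tensorπIsColimit (homX f) (homX g))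

/-- The map `B ⟶ B ⊗_A D`. -/
noncomputable def pushoutInl : B ⟶ pushoutObj f g :=
  ofHomX (tensorInl B.X D.X ≫ pushoutπ f g)

/-- The map `D ⟶ B ⊗_A D`. -/
noncomputable def pushoutInr : D ⟶ pushoutObj f g :=
  ofHomX (tensorInr B.X D.X ≫ pushoutπ f g)

lemma homX_pushoutInl : homX (pushoutInl f g) = tensorInl B.X D.X ≫ pushoutπ f g := rfl

lemma homX_pushoutInr : homX (pushoutInr f g) = tensorInr B.X D.X ≫ pushoutπ f g := rfl

lemma homX_pushoutInr_eq : homX (pushoutInr f g) = tensorUnit (homX f) (algMod (homX g)) :=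
  Category.assoc _ _ _

lemma tensorHom_pushoutπ :
    (homX (pushoutInl f g) ⊗ₘ homX (pushoutInr f g)) ≫ μ = pushoutπ f g := by
  rw [homX_pushoutInl, homX_pushoutInr, ← tensorHom_comp_tensorHom_assoc, ← IsMonHom.mul_hom,
    ← Category.assoc, inl_tensorHom_inr_mul, Category.id_comp]

lemma one_whiskerRight_mul {K E : C} [MonObj E] (s : K ⟶ E) :
    (ρ_ K).inv ≫ K ◁ η ≫ s ▷ E ≫ μ = s := by
  rw [whisker_exchange_assoc, MonObj.mul_one]
  simp

lemma pushoutπ_pair : ((homX f ≫ tensorInl B.X D.X) ▷ (B.X ⊗ D.X) ≫ μ) ≫ pushoutπ f g =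
    ((homX g ≫ tensorInr B.X D.X) ▷ (B.X ⊗ D.X) ≫ μ) ≫ pushoutπ f g :=
  tensorπ_pair (homX f) (homX g)

lemma pushout_condition : f ≫ pushoutInl f g = g ≫ pushoutInr f g := by
  apply homX_injective
  have h := congr((ρ_ A.X).inv ≫ A.X ◁ η ≫ $(pushoutπ_pair f g))
  rw [Category.assoc, Category.assoc, reassoc_of% one_whiskerRight_mul (homX f ≫ _),
    reassoc_of% one_whiskerRight_mul (homX g ≫ _)] at h
  simpa [homX_pushoutInl, homX_pushoutInr] using h

lemma pushoutπ_homX {T : CommMon C} (h : pushoutObj f g ⟶ T) :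
    pushoutπ f g ≫ homX h =
      (homX (pushoutInl f g ≫ h) ⊗ₘ homX (pushoutInr f g ≫ h)) ≫ μ := by
  rw [← tensorHom_pushoutπ, Category.assoc, IsMonHom.mul_hom, tensorHom_comp_tensorHom_assoc,
    homX_comp, homX_comp]

lemma pushoutObj_hom_ext {T : CommMon C} {h k : pushoutObj f g ⟶ T}
    (h₁ : pushoutInl f g ≫ h = pushoutInl f g ≫ k)
    (h₂ : pushoutInr f g ≫ h = pushoutInr f g ≫ k) : h = k := by
  apply homX_injective
  rw [← cancel_epi (pushoutπ f g), pushoutπ_homX, pushoutπ_homX, h₁, h₂]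

lemma exists_pushoutObj_desc {T : CommMon C} (b : B ⟶ T) (d : D ⟶ T) (h : f ≫ b = g ≫ d) :
    ∃ l : pushoutObj f g ⟶ T, pushoutInl f g ≫ l = b ∧ pushoutInr f g ≫ l = d := by
  let k : B.X ⊗ D.X ⟶ T.X := (homX b ⊗ₘ homX d) ≫ μ
  obtain ⟨(l : (pushoutObj f g).X ⟶ T.X), hl⟩ := Cofork.IsColimit.desc' (tensorπIsColimit (homX f) (homX g)) k (by
    have h' : homX f ≫ homX b = homX g ≫ homX d := congr(homX $h)
    have e (s : A.X ⟶ B.X ⊗ D.X) : (s ▷ (B.X ⊗ D.X) ≫ μ) ≫ k = (s ≫ k) ▷ _ ≫ T.X ◁ k ≫ μ := by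
      rw [Category.assoc, IsMonHom.mul_hom, MonoidalCategory.tensorHom_def]
      simp
    rw [e, e, Category.assoc, Category.assoc, tensorInl_tensorHom_mul, tensorInr_tensorHom_mul, h'])
  replace hl : pushoutπ f g ≫ l = k := hl
  have : IsMonHom (pushoutπ f g ≫ l) := by rw [hl]; infer_instance
  have : IsMonHom l := isMonHom_of_quotient (q := pushoutπ f g) l
  refine ⟨ofHomX l, homX_injective ?_, homX_injective ?_⟩
  · rw [homX_comp, homX_pushoutInl, Category.assoc, homX_ofHomX, hl, tensorInl_tensorHom_mul]
  · rw [homX_comp, homX_pushoutInr, Category.assoc, homX_ofHomX, hl, tensorInr_tensorHom_mul]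

lemma isPushout_pushoutObj : IsPushout f g (pushoutInl f g) (pushoutInr f g) where
  w := pushout_condition f g
  isColimit' := ⟨PushoutCocone.IsColimit.mk _
    (fun s ↦ (exists_pushoutObj_desc f g s.inl s.inr s.condition).choose)
    (fun s ↦ (exists_pushoutObj_desc f g s.inl s.inr s.condition).choose_spec.1)
    (fun s ↦ (exists_pushoutObj_desc f g s.inl s.inr s.condition).choose_spec.2)
    (fun s _ h₁ h₂ ↦ pushoutObj_hom_ext f g
      (h₁.trans (exists_pushoutObj_desc f g s.inl s.inr s.condition).choose_spec.1.symm)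
      (h₂.trans (exists_pushoutObj_desc f g s.inl s.inr s.condition).choose_spec.2.symm))⟩

instance : HasPushouts (CommMon C) :=
  have {X Y Z : CommMon C} {f : X ⟶ Y} {g : X ⟶ Z} : HasColimit (span f g) :=
    (isPushout_pushoutObj f g).hasPushout
  hasPushouts_of_hasColimit_span _

end Pushout

end RelSch

namespace RelSch

section Action

variable {C : Type u} [Category.{v} C] [MonoidalCategory C] {A : C} [MonObj A]

/-- The action of `A` on an `A`-module. -/
def act (M : Mod C A) : A ⊗ M.X ⟶ M.X := ModObj.smul (M := A) (X := M.X)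

lemma mul_act (M : Mod C A) : μ ▷ M.X ≫ act M = (α_ A A M.X).hom ≫ A ◁ act M ≫ act M :=
  ModObj.mul_smul_self A M.X

lemma one_act (M : Mod C A) : η ▷ M.X ≫ act M = (λ_ M.X).hom :=
  ModObj.one_smul_self A M.X

lemma act_hom {M N : Mod C A} (h : M ⟶ N) : act M ≫ h.hom = A ◁ h.hom ≫ act N :=
  h.isModHom.smul_hom

end Action

section BeckChevalley

set_option linter.unusedSectionVars false

variable {C : Type u} [Category.{v} C] [MonoidalCategory C] [SymmetricCategory C]
  [MonoidalClosed C] [HasColimits C] {A B D : CommMon C} (f : A ⟶ B) (g : A ⟶ D)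
  (M : Mod C D.X)

/-- The projection `B ⊗ M ⟶ B ⊗_A M` for a `D`-module `M`. -/
noncomputable def restrictπ : B.X ⊗ M.X ⟶ tensorObj (homX f) ((Mod.comap (homX g)).obj M) :=
  tensorπ (homX f) ((Mod.comap (homX g)).obj M)

instance : Epi (restrictπ f g M) := inferInstanceAs (Epi (tensorπ _ _))

lemma restrictπ_condition :
    ((α_ B.X A.X M.X).inv ≫ (B.X ◁ homX f ≫ μ) ▷ M.X) ≫ restrictπ f g M =
      B.X ◁ (homX g ▷ M.X ≫ act M) ≫ restrictπ f g M :=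
  coequalizer.condition ((α_ B.X A.X M.X).inv ≫ (B.X ◁ homX f ≫ μ) ▷ M.X)
    (B.X ◁ (homX g ▷ M.X ≫ act M))

lemma exists_restrictπ_desc {T : C} (k : B.X ⊗ M.X ⟶ T)
    (h : ((α_ B.X A.X M.X).inv ≫ (B.X ◁ homX f ≫ μ) ▷ M.X) ≫ k =
      B.X ◁ (homX g ▷ M.X ≫ act M) ≫ k) : ∃ l, restrictπ f g M ≫ l = k :=
  ⟨coequalizer.desc k h, coequalizer.π_desc _ _⟩

lemma tensorπ_condition (N : Mod C A.X) :
    ((α_ B.X A.X N.X).inv ≫ (B.X ◁ homX f ≫ μ) ▷ N.X) ≫ tensorπ (homX f) N =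
      B.X ◁ act N ≫ tensorπ (homX f) N :=
  coequalizer.condition _ _

lemma exists_tensorπ_desc (N : Mod C A.X) {T : C} (k : B.X ⊗ N.X ⟶ T)
    (h : ((α_ B.X A.X N.X).inv ≫ (B.X ◁ homX f ≫ μ) ▷ N.X) ≫ k =
      B.X ◁ act N ≫ k) : ∃ l, tensorπ (homX f) N ≫ l = k :=
  ⟨coequalizer.desc k h, coequalizer.π_desc _ _⟩

/-- The map `B ⊗ M ⟶ (B ⊗_A D) ⊗_D M`. -/
noncomputable def pushoutσ : B.X ⊗ M.X ⟶ tensorObj (homX (pushoutInr f g)) M :=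
  homX (pushoutInl f g) ▷ M.X ≫ tensorπ (homX (pushoutInr f g)) M

lemma pushoutπ_tensorπ :
    pushoutπ f g ▷ M.X ≫ tensorπ (homX (pushoutInr f g)) M =
      (α_ B.X D.X M.X).hom ≫ B.X ◁ act M ≫ pushoutσ f g M := by
  have h := tensorπ_condition (pushoutInr f g) M
  rw [← tensorHom_pushoutπ, MonoidalCategory.tensorHom_def, Category.assoc, comp_whiskerRight,
    Category.assoc, pushoutσ, whisker_exchange_assoc, ← h]
  simp

lemma pushoutσ_condition :
    ((α_ B.X A.X M.X).inv ≫ (B.X ◁ homX f ≫ μ) ▷ M.X) ≫ pushoutσ f g M =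
      B.X ◁ (homX g ▷ M.X ≫ act M) ≫ pushoutσ f g M := by
  have h : B.X ◁ homX f ≫ μ ≫ homX (pushoutInl f g) = B.X ◁ homX g ≫ pushoutπ f g := by
    rw [← tensorHom_pushoutπ, IsMonHom.mul_hom, whiskerLeft_comp_tensorHom_assoc,
      whiskerLeft_comp_tensorHom_assoc, ← homX_comp, ← homX_comp, pushout_condition]
  have h' := (α_ _ _ _).inv ≫= pushoutπ_tensorπ f g M
  rw [Iso.inv_hom_id_assoc] at h'
  rw [MonoidalCategory.whiskerLeft_comp, Category.assoc, Category.assoc, ← h',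
    associator_inv_naturality_middle_assoc, ← comp_whiskerRight_assoc, ← h, pushoutσ]
  simp only [comp_whiskerRight, Category.assoc]

lemma exists_pushoutκ : ∃ κ : (pushoutObj f g).X ⊗ M.X ⟶ _,
    pushoutπ f g ▷ M.X ≫ κ = (α_ B.X D.X M.X).hom ≫ B.X ◁ act M ≫ restrictπ f g M := by
  have hq : IsColimit (Cofork.ofπ (pushoutπ f g) (f := (α_ B.X A.X D.X).inv ≫ (B.X ◁ homX f ≫ μ) ▷ D.X)
    (g := B.X ◁ (homX g ▷ D.X ≫ μ)) (tensorπ_algMod_condition _ _)) := coequalizerIsCoequalizer _ _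
  refine exists_whiskerRight_desc hq M.X _ ?_
  have h : (B.X ◁ homX f ≫ μ) ▷ M.X ≫ restrictπ f g M =
      (α_ _ _ _).hom ≫ B.X ◁ (homX g ▷ M.X ≫ act M) ≫ restrictπ f g M := by
    rw [← restrictπ_condition, Category.assoc, Iso.hom_inv_id_assoc]
  have h' : (homX g ▷ D.X ≫ μ) ▷ M.X ≫ act M =
      (α_ _ _ _).hom ≫ A.X ◁ act M ≫ homX g ▷ M.X ≫ act M := by
    rw [comp_whiskerRight, Category.assoc, mul_act, associator_naturality_left_assoc,
      whisker_exchange_assoc]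
  rw [comp_whiskerRight, Category.assoc, associator_naturality_left_assoc,
    ← whisker_exchange_assoc, h, associator_naturality_middle_assoc,
    ← MonoidalCategory.whiskerLeft_comp_assoc, h']
  simp

lemma pushoutπ_mul : pushoutπ f g ▷ D.X ≫ (pushoutObj f g).X ◁ homX (pushoutInr f g) ≫ μ =
    (α_ _ _ _).hom ≫ B.X ◁ μ ≫ pushoutπ f g := by
  rw [← tensorHom_pushoutπ, whiskerLeft_comp_tensorHom_assoc, IsMonHom.mul_hom,
    ← tensorHom_id, ← id_tensorHom, tensorHom_comp_tensorHom_assoc]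
  simp only [mon_tauto]

lemma exists_pushoutκ_desc (κ : (pushoutObj f g).X ⊗ M.X ⟶ _)
    (hκ : pushoutπ f g ▷ M.X ≫ κ = (α_ B.X D.X M.X).hom ≫ B.X ◁ act M ≫ restrictπ f g M) :
    ∃ l, tensorπ (homX (pushoutInr f g)) M ≫ l = κ := by
  apply exists_tensorπ_desc
  rw [← cancel_epi (pushoutπ f g ▷ _), ← whisker_exchange_assoc, hκ]
  have h := pushoutπ_mul f g
  rw [Category.assoc, associator_inv_naturality_left_assoc, ← comp_whiskerRight_assoc, h,
    comp_whiskerRight, comp_whiskerRight, Category.assoc, Category.assoc, hκ,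
    associator_naturality_middle_assoc, ← MonoidalCategory.whiskerLeft_comp_assoc, mul_act]
  simp

/-- The base change map `B ⊗_A M ⟶ (B ⊗_A D) ⊗_D M`. -/
noncomputable def pushoutθ : tensorObj (homX f) ((Mod.comap (homX g)).obj M) ⟶
    tensorObj (homX (pushoutInr f g)) M :=
  (exists_restrictπ_desc f g M _ (pushoutσ_condition f g M)).choose

lemma restrictπ_pushoutθ : restrictπ f g M ≫ pushoutθ f g M = pushoutσ f g M :=
  (exists_restrictπ_desc f g M _ (pushoutσ_condition f g M)).choose_spec

instance : IsIso (pushoutθ f g M) := by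
  obtain ⟨κ, hκ⟩ := exists_pushoutκ f g M
  obtain ⟨l, hl⟩ := exists_pushoutκ_desc f g M κ hκ
  refine ⟨l, ?_, ?_⟩
  · rw [← cancel_epi (restrictπ f g M), reassoc_of% restrictπ_pushoutθ f g M, pushoutσ,
      Category.assoc, hl, homX_pushoutInl, comp_whiskerRight, Category.assoc, hκ]
    have h : η ▷ M.X ≫ act M = (λ_ M.X).hom := one_act M
    simp only [tensorInl, comp_whiskerRight, Category.assoc, associator_naturality_middle_assoc,
      ← MonoidalCategory.whiskerLeft_comp_assoc, h]
    simp
  · rw [← cancel_epi (tensorπ _ _), reassoc_of% hl, ← cancel_epi (pushoutπ f g ▷ M.X),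
      reassoc_of% hκ, restrictπ_pushoutθ, Category.comp_id, pushoutπ_tensorπ]

end BeckChevalley

end RelSch

namespace RelSch

section ModuleLimits

variable {C : Type u} [Category.{v} C] [MonoidalCategory C] (A : C) [MonObj A]

/-- The monad `A ⊗ -`. -/
def tensorMonad : Monad C :=
  ⟨tensorLeft A,
    { app X := (λ_ X).inv ≫ η ▷ X
      naturality X Y f := by
        dsimp
        rw [Category.assoc, ← whisker_exchange, leftUnitor_inv_naturality_assoc] },
    { app X := (α_ A A X).inv ≫ μ ▷ X
      naturality X Y f := by
        dsimp
        rw [Category.assoc, ← whisker_exchange, ← associator_inv_naturality_right_assoc] },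
    fun X ↦ by
      dsimp
      rw [MonoidalCategory.whiskerLeft_comp, Category.assoc, Category.assoc,
        associator_inv_naturality_middle_assoc, associator_inv_naturality_left_assoc,
        ← comp_whiskerRight, ← comp_whiskerRight, MonObj.mul_assoc]
      simp,
    fun X ↦ by
      dsimp
      rw [Category.assoc, associator_inv_naturality_left_assoc, ← comp_whiskerRight, MonObj.one_mul]
      simp,
    fun X ↦ by
      dsimp
      rw [MonoidalCategory.whiskerLeft_comp, Category.assoc,
        associator_inv_naturality_middle_assoc, ← comp_whiskerRight, MonObj.mul_one]
      simp⟩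

/-- The comparison functor from `A`-modules to algebras over the monad `A ⊗ -`. -/
def modToAlgebra : Mod C A ⥤ (tensorMonad A).Algebra where
  obj M :=
    { A := M.X
      a := act M
      unit := by
        change ((λ_ M.X).inv ≫ η ▷ M.X) ≫ act M = 𝟙 _
        rw [Category.assoc, one_act, Iso.inv_hom_id]
      assoc := by
        change ((α_ A A M.X).inv ≫ μ ▷ M.X) ≫ act M = A ◁ act M ≫ act M
        rw [Category.assoc, mul_act, Iso.inv_hom_id_assoc] }
  map h :=
    { f := h.hom
      h := (act_hom h).symm }

instance : (modToAlgebra A).Faithful where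
  map_injective h := Mod.hom_ext _ _ congr(Monad.Algebra.Hom.f $h)

instance : (modToAlgebra A).Full where
  map_surjective h := ⟨Mod.Hom.mk' h.f h.h.symm, rfl⟩

instance : (modToAlgebra A).EssSurj where
  mem_essImage N := 
    let M : Mod C A :=
      { X := N.A
        mod :=
          { smul := N.a
            one_smul := by
              rw [← cancel_epi (λ_ N.A).inv]
              have := N.unit
              exact ((Category.assoc _ _ _).symm.trans this).trans (Iso.inv_hom_id _).symm
            mul_smul := by
              rw [← cancel_epi (α_ A A N.A).inv]
              have := N.assoc
              refine ((Category.assoc _ _ _).symm.trans this).trans ?_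
              exact (Iso.inv_hom_id_assoc _ _).symm } }
    ⟨M, ⟨Monad.Algebra.isoMk (Iso.refl _) (by
      exact ((tensorLeft A).map_id _ =≫ N.a).trans
        ((Category.id_comp _).trans (Category.comp_id _).symm))⟩⟩

instance : (modToAlgebra A).IsEquivalence where

instance (J : Type*) [Category* J] [HasLimitsOfShape J C] : HasLimitsOfShape J (Mod C A) :=
  have : HasLimitsOfShape J (tensorMonad A).Algebra :=
    hasLimitsOfShape_of_hasLimitsOfShape_createsLimitsOfShape (tensorMonad A).forget
  Adjunction.hasLimitsOfShape_of_equivalence (modToAlgebra A)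

instance (J : Type*) [Category* J] : PreservesLimitsOfShape J (Mod.forget (D := C) A) :=
  inferInstanceAs (PreservesLimitsOfShape J (modToAlgebra A ⋙ (tensorMonad A).forget))

instance : (Mod.forget (D := C) A).ReflectsIsomorphisms :=
  inferInstanceAs ((modToAlgebra A ⋙ (tensorMonad A).forget).ReflectsIsomorphisms)

end ModuleLimits

section Flat

variable {C : Type u} [Category.{v} C] [MonoidalCategory C] [SymmetricCategory C]
  [MonoidalClosed C] [HasColimits C] {A B D : CommMon C} 

/-- Extension of scalars along a morphism of commutative monoids. -/
noncomputable abbrev extendScalars (f : A ⟶ B) : Mod C A.X ⥤ Mod C B.X := baseChange (homX f)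

/-- The map `B ⊗_A M ⟶ B ⊗_A N` induced by `M ⟶ N`. -/
noncomputable def extendMap (f : A ⟶ B) {M N : Mod C A.X} (h : M ⟶ N) :
    tensorObj (homX f) M ⟶ tensorObj (homX f) N :=
  ((extendScalars f).map h).hom

lemma tensorπ_extendMap (f : A ⟶ B) {M N : Mod C A.X} (h : M ⟶ N) :
    tensorπ (homX f) M ≫ extendMap f h = B.X ◁ h.hom ≫ tensorπ (homX f) N := by
  have h1 := whiskerLeft_tensorUnit_act (homX f) N
  let k := h ≫ tensorHomEquiv (homX f) N (tensorMod (homX f) N) (𝟙 _)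
  refine (tensorπ_desc (homX f) M (tensorMod (homX f) N) k.hom k.isModHom.smul_hom).trans ?_
  change B.X ◁ (h.hom ≫ tensorUnit (homX f) N ≫ 𝟙 _) ≫ tensorAct (homX f) N = _
  rw [Category.comp_id, MonoidalCategory.whiskerLeft_comp, Category.assoc, h1]

/-- The base change isomorphism `B ⊗_A M ≅ (B ⊗_A D) ⊗_D M`. -/
noncomputable def pushoutθIso (f : A ⟶ B) (g : A ⟶ D) (M : Mod C D.X) :
    tensorObj (homX f) ((Mod.comap (homX g)).obj M) ≅ tensorObj (homX (pushoutInr f g)) M :=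
  asIso (pushoutθ f g M)

/-- The Beck-Chevalley isomorphism for a pushout square of commutative monoids. -/
noncomputable def pushoutIso (f : A ⟶ B) (g : A ⟶ D) :
    Mod.comap (D := C) (homX g) ⋙ extendScalars f ⋙ Mod.forget _ ≅
      extendScalars (pushoutInr f g) ⋙ Mod.forget _ :=
  NatIso.ofComponents (fun M ↦ pushoutθIso f g M) (fun {M N} h ↦ by
    change extendMap f ((Mod.comap (D := C) (homX g)).map h) ≫ pushoutθ f g N =
      pushoutθ f g M ≫ extendMap (pushoutInr f g) h
    have h1 : restrictπ f g M ≫ extendMap f ((Mod.comap (D := C) (homX g)).map h) =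
      B.X ◁ h.hom ≫ restrictπ f g N := tensorπ_extendMap f ((Mod.comap (D := C) (homX g)).map h)
    rw [← cancel_epi (restrictπ f g M), reassoc_of% h1, restrictπ_pushoutθ,
      reassoc_of% restrictπ_pushoutθ f g M, pushoutσ, pushoutσ, Category.assoc, tensorπ_extendMap,
      whisker_exchange_assoc])

end Flat

end RelSch

namespace RelSch

section FlatMorphisms

set_option linter.unusedSectionVars false

variable {C : Type u} [Category.{v} C] [MonoidalCategory C] [SymmetricCategory C]
  {A B D : CommMon C}

/-- Restriction of scalars along a composition. -/
def restrictComp (f : A ⟶ B) (g : B ⟶ D) (k : A ⟶ D) (h : f ≫ g = k) :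
    Mod.comap (D := C) (homX k) ≅ Mod.comap (homX g) ⋙ Mod.comap (homX f) :=
  have e (M : Mod C D.X) : homX f ▷ M.X ≫ homX g ▷ M.X ≫ act M = homX k ▷ M.X ≫ act M := by
    rw [← h, homX_comp, comp_whiskerRight, Category.assoc]
  NatIso.ofComponents (fun M ↦
    { hom := Mod.Hom.mk' (M := (Mod.comap (homX k)).obj M)
        (N := (Mod.comap (homX g) ⋙ Mod.comap (homX f)).obj M) (𝟙 M.X) (by
          change (homX k ▷ M.X ≫ act M) ≫ 𝟙 _ = A.X ◁ 𝟙 M.X ≫ homX f ▷ M.X ≫ homX g ▷ M.X ≫ act M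
          rw [e]; simp)
      inv := Mod.Hom.mk' (N := (Mod.comap (homX k)).obj M)
        (M := (Mod.comap (homX g) ⋙ Mod.comap (homX f)).obj M) (𝟙 M.X) (by
          change (homX f ▷ M.X ≫ homX g ▷ M.X ≫ act M) ≫ 𝟙 _ = A.X ◁ 𝟙 M.X ≫ homX k ▷ M.X ≫ act M
          rw [e]; simp)
      hom_inv_id := Mod.hom_ext _ _ (Category.comp_id _)
      inv_hom_id := Mod.hom_ext _ _ (Category.comp_id _) })
    (fun h ↦ Mod.hom_ext _ _ ((Category.comp_id _).trans (Category.id_comp _).symm))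

variable (C A) in
/-- Restriction of scalars along the identity. -/
def restrictId : Mod.comap (D := C) (homX (𝟙 A)) ≅ 𝟭 _ :=
  have e (M : Mod C A.X) : homX (𝟙 A) ▷ M.X ≫ act M = act M := by simp
  NatIso.ofComponents (fun M ↦
    { hom := Mod.Hom.mk' (M := (Mod.comap (homX (𝟙 A))).obj M) (N := M) (𝟙 M.X) (by
          change (homX (𝟙 A) ▷ M.X ≫ act M) ≫ 𝟙 _ = A.X ◁ 𝟙 M.X ≫ act M
          rw [e]; simp)
      inv := Mod.Hom.mk' (N := (Mod.comap (homX (𝟙 A))).obj M) (M := M) (𝟙 M.X) (by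
          change act M ≫ 𝟙 _ = A.X ◁ 𝟙 M.X ≫ homX (𝟙 A) ▷ M.X ≫ act M
          rw [e]; simp)
      hom_inv_id := Mod.hom_ext _ _ (Category.comp_id _)
      inv_hom_id := Mod.hom_ext _ _ (Category.comp_id _) })
    (fun h ↦ Mod.hom_ext _ _ ((Category.comp_id _).trans (Category.id_comp _).symm))

instance (f : A ⟶ B) [IsIso f] : (Mod.comap (D := C) (homX f)).IsEquivalence :=
  (CategoryTheory.Equivalence.mk (Mod.comap (D := C) (homX f)) (Mod.comap (homX (inv f)))
    ((restrictId C B).symm ≪≫ restrictComp (inv f) f (𝟙 B) (by simp))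
    ((restrictComp f (inv f) (𝟙 A) (by simp)).symm ≪≫ restrictId C A)).isEquivalence_functor

variable [MonoidalClosed C] [HasColimits C]

/-- Extension of scalars along a composition. -/
noncomputable def extendComp (f : A ⟶ B) (g : B ⟶ D) :
    extendScalars f ⋙ extendScalars g ≅ extendScalars (f ≫ g) :=
  (((baseChangeAdj (homX f)).comp (baseChangeAdj (homX g))).ofNatIsoRight
    (restrictComp f g _ rfl).symm).leftAdjointUniq (baseChangeAdj _)

instance (f : A ⟶ B) [IsIso f] : (extendScalars f).IsEquivalence :=
  (baseChangeAdj (homX f)).isEquivalence_left_of_isEquivalence_right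

/-- A morphism of commutative monoids is flat if extension of scalars is exact. -/
def Flat (f : A ⟶ B) : Prop := PreservesFiniteLimits (extendScalars f)

lemma flat_of_isIso (f : A ⟶ B) [IsIso f] : Flat f := by
  unfold Flat
  infer_instance

lemma Flat.comp {f : A ⟶ B} {g : B ⟶ D} (hf : Flat f) (hg : Flat g) : Flat (f ≫ g) := by
  unfold Flat at *
  have := comp_preservesFiniteLimits (extendScalars f) (extendScalars g)
  exact preservesFiniteLimits_of_natIso (extendComp f g)

lemma flat_iff_forget [HasLimits C] (f : A ⟶ B) :
    Flat f ↔ PreservesFiniteLimits (extendScalars f ⋙ Mod.forget _) := by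
  unfold Flat
  refine ⟨fun _ ↦ ⟨fun J _ _ ↦ inferInstance⟩, fun _ ↦ ⟨fun J _ _ ↦ ?_⟩⟩
  have : ReflectsLimitsOfShape J (Mod.forget (D := C) B.X) :=
    reflectsLimitsOfShape_of_reflectsIsomorphisms
  exact preservesLimitsOfShape_of_reflects_of_preserves _ (Mod.forget _)

lemma Flat.pushoutInr [HasLimits C] {f : A ⟶ B} (hf : Flat f) (g : A ⟶ D) :
    Flat (pushoutInr f g) := by
  rw [flat_iff_forget] at hf ⊢
  have := (baseChangeAdj (homX g)).rightAdjoint_preservesLimits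
  have := comp_preservesFiniteLimits (Mod.comap (D := C) (homX g)) (extendScalars f ⋙ Mod.forget _)
  exact preservesFiniteLimits_of_natIso (pushoutIso f g)

lemma Flat.of_isPushout [HasLimits C] {P : CommMon C} {f : A ⟶ B} {g : A ⟶ D} {i : B ⟶ P}
    {j : D ⟶ P} (h : IsPushout f g i j) (hf : Flat f) : Flat j := by
  rw [← (isPushout_pushoutObj f g).inr_isoIsPushout_hom _ _ h]
  exact (hf.pushoutInr g).comp (flat_of_isIso _)

end FlatMorphisms

section FinitePresentation

universe v' u' w

variable {E : Type u'} [Category.{v'} E] {X Y Z W : E}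

open MorphismProperty

lemma isFinitelyPresentable_iff_exists (f : X ⟶ Y) : isFinitelyPresentable.{w} E f ↔
    ∀ (J : Type w) (_ : SmallCategory J) (_ : IsFiltered J) (F : J ⥤ E)
      (s : (Functor.const J).obj X ⟶ F) (c : Cocone F) (_ : IsColimit c),
      (∀ k : Y ⟶ c.pt, (∀ j, f ≫ k = s.app j ≫ c.ι.app j) →
        ∃ j, ∃ l : Y ⟶ F.obj j, f ≫ l = s.app j ∧ l ≫ c.ι.app j = k) ∧
      (∀ j (k l : Y ⟶ F.obj j), f ≫ k = s.app j → f ≫ l = s.app j →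
        k ≫ c.ι.app j = l ≫ c.ι.app j → ∃ j', ∃ t : j ⟶ j', k ≫ F.map t = l ≫ F.map t) := by
  constructor
  · intro hf J _ _ F s c hc
    have : IsFinitelyPresentable.{w} (Under.mk f) := hf
    refine ⟨fun k hk ↦ ?_, fun j k l hk hl h ↦ ?_⟩
    · exact exists_hom_of_isFinitelyPresentable hc hf s k (fun j ↦ (hk j).symm)
    · have : Nonempty J := IsFiltered.nonempty
      have hs j' : s.app j' ≫ c.ι.app j' = s.app j ≫ c.ι.app j := by
        have h i i' (t : i ⟶ i') : s.app i ≫ c.ι.app i = s.app i' ≫ c.ι.app i' := by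
          rw [← c.w t, ← NatTrans.naturality_assoc]
          simp
        rw [h _ _ (IsFiltered.leftToMax j' j), h _ _ (IsFiltered.rightToMax j' j)]
      let hc' := Under.isColimitLiftCocone F s c (s.app j ≫ c.ι.app j) hs hc
      obtain ⟨i, p, q, e⟩ := IsFinitelyPresentable.exists_eq_of_isColimit hc' (X := Under.mk f)
        (i := j) (j := j) (Under.homMk k hk) (Under.homMk l hl) (by ext; exact h)
      replace e : k ≫ F.map p = l ≫ F.map q := congr(($e).right)
      refine ⟨_, p ≫ IsFiltered.coeqHom p q, ?_⟩
      rw [F.map_comp, reassoc_of% e, ← F.map_comp, ← F.map_comp, IsFiltered.coeq_condition]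
  · intro h
    change IsFinitelyPresentable.{w} (Under.mk f)
    rw [isFinitelyPresentable_iff_preservesFilteredColimitsOfSize]
    refine ⟨fun J _ _ ↦ ⟨fun {F} ↦ ⟨fun {c} hc ↦ ⟨?_⟩⟩⟩⟩
    have := IsFiltered.isConnected J
    obtain ⟨h1, h2⟩ := h J _ inferInstance (F ⋙ Under.forget X) { app j := (F.obj j).hom } _
      (isColimitOfPreserves (Under.forget X) hc)
    refine Types.FilteredColimit.isColimitOf' _ _ (fun k ↦ ?_) (fun j k l e ↦ ?_)
    · obtain ⟨j, l, hl, e⟩ := h1 k.right (fun j ↦ (Under.w k).trans (Under.w (c.ι.app j)).symm)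
      exact ⟨j, Under.homMk l hl, Under.UnderMorphism.ext e.symm⟩
    · obtain ⟨j', t, ht⟩ := h2 j k.right l.right (Under.w k) (Under.w l) congr(($e).right)
      exact ⟨j', t, Under.UnderMorphism.ext ht⟩

lemma isFinitelyPresentable_of_isIso (f : X ⟶ Y) [IsIso f] : isFinitelyPresentable.{w} E f := by
  rw [isFinitelyPresentable_iff_exists]
  intro J _ _ F s c hc
  refine ⟨fun k hk ↦ ?_, fun j k l hk hl h ↦ ⟨j, 𝟙 j, ?_⟩⟩
  · obtain ⟨j⟩ : Nonempty J := IsFiltered.nonempty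
    exact ⟨j, inv f ≫ s.app j, by simp, by simp [← hk]⟩
  · rw [(cancel_epi f).1 (hk.trans hl.symm)]

lemma isFinitelyPresentable_of_isPushout {f : X ⟶ Y} {g : X ⟶ Z} {i : Y ⟶ W} {j : Z ⟶ W}
    (h : IsPushout f g i j) (hf : isFinitelyPresentable.{w} E f) :
    isFinitelyPresentable.{w} E j := by
  rw [isFinitelyPresentable_iff_exists] at hf ⊢
  intro J _ _ F s c hc
  obtain ⟨h1, h2⟩ := hf J _ ‹_› F ((Functor.const J).map g ≫ s) c hc
  refine ⟨fun k hk ↦ ?_, fun a k l hk hl e ↦ ?_⟩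
  · obtain ⟨a, l, hl, e⟩ := h1 (i ≫ k) (fun a ↦ by simp [reassoc_of% h.w, hk a])
    replace hl : f ≫ l = g ≫ s.app a := hl
    refine ⟨a, h.desc l (s.app a) hl, by simp, h.hom_ext ?_ ?_⟩
    · rw [IsPushout.inl_desc_assoc, e]
    · rw [IsPushout.inr_desc_assoc, hk]
  · obtain ⟨b, t, ht⟩ := h2 a (i ≫ k) (i ≫ l) (by simp [reassoc_of% h.w, hk])
      (by simp [reassoc_of% h.w, hl]) (by simp [e])
    refine ⟨b, t, h.hom_ext (by simpa using ht) (by simp [reassoc_of% hk, reassoc_of% hl])⟩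

lemma isFinitelyPresentable_comp {f : X ⟶ Y} {g : Y ⟶ Z} [Epi f]
    (hf : isFinitelyPresentable.{w} E f) (hg : isFinitelyPresentable.{w} E g) :
    isFinitelyPresentable.{w} E (f ≫ g) := by
  rw [isFinitelyPresentable_iff_exists] at *
  intro J _ _ F s c hc
  obtain ⟨h1, h2⟩ := hf J _ ‹_› F s c hc
  have key (a : J) (q : Y ⟶ F.obj a) (hq : f ≫ q = s.app a) :=
    hg (Under a) _ inferInstance (Under.forget a ⋙ F)
      { app b := q ≫ F.map b.hom
        naturality b b' t := by simp [← F.map_comp] } (c.whisker (Under.forget a))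
      ((Functor.Final.isColimitWhiskerEquiv _ _).symm hc)
  refine ⟨fun k hk ↦ ?_, fun a k l hk hl e ↦ ?_⟩
  · obtain ⟨a, q, hq, e⟩ := h1 (g ≫ k) (fun j ↦ by simp [← hk])
    obtain ⟨b, (l : Z ⟶ F.obj b.right), hl, e'⟩ := (key a q hq).1 k (fun b ↦ by simp [e])
    refine ⟨b.right, l, ?_, e'⟩
    replace hl : g ≫ l = q ≫ F.map b.hom := hl
    rw [Category.assoc, hl, reassoc_of% hq]
    exact (s.naturality b.hom).symm.trans (Category.id_comp _)
  · obtain ⟨b, t, ht⟩ := (key a (g ≫ k) (by simpa using hk)).2 (Under.mk (𝟙 a)) k l (by simp)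
      (by
        simp
        rw [← cancel_epi f]
        simpa using hl.trans hk.symm) e
    exact ⟨b.right, t.right, ht⟩

end FinitePresentation

end RelSch

namespace RelSch

section AffineOpens

set_option linter.unusedSectionVars false

variable {C : Type u} [Category.{v} C] [MonoidalCategory C] [SymmetricCategory C]
  [MonoidalClosed C] [HasColimits C]

section

variable {A B D : CommMon C}

lemma isIso_of_isIso_restrict (g : A ⟶ D) {M N : Mod C D.X} (h : M ⟶ N)
    [IsIso ((Mod.comap (homX g)).map h)] : IsIso h := by
  have : IsIso ((Mod.forget (D := C) D.X).map h) :=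
    inferInstanceAs (IsIso ((Mod.forget _).map ((Mod.comap (D := C) (homX g)).map h)))
  exact isIso_of_reflects_iso h (Mod.forget (D := C) D.X)

lemma isIso_extendScalars_map_of_isPushout {P : CommMon C} {f : A ⟶ B} {g : A ⟶ D} {i : B ⟶ P}
    {j : D ⟶ P} (sq : IsPushout f g i j) {M N : Mod C D.X} (h : M ⟶ N)
    [IsIso ((extendScalars j).map h)] :
    IsIso ((extendScalars f).map ((Mod.comap (homX g)).map h)) := by
  obtain ⟨e, he, hj⟩ : ∃ (e : pushoutObj f g ⟶ P), IsIso e ∧ pushoutInr f g ≫ e = j :=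
    ⟨((isPushout_pushoutObj f g).isoIsPushout _ _ sq).hom, inferInstance,
      IsPushout.inr_isoIsPushout_hom ..⟩
  subst hj
  have h1 : IsIso ((extendScalars (pushoutInr f g) ⋙ extendScalars e).map h) :=
    ((NatIso.isIso_map_iff (extendComp (pushoutInr f g) e) h)).2 inferInstance
  have h1' : IsIso ((extendScalars e).map ((extendScalars (pushoutInr f g)).map h)) := h1
  have h2 : IsIso ((extendScalars (pushoutInr f g)).map h) :=
    isIso_of_reflects_iso _ (extendScalars e)
  have h3 := ((NatIso.isIso_map_iff (pushoutIso f g) h)).2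
    (inferInstanceAs (IsIso ((Mod.forget _).map ((extendScalars (pushoutInr f g)).map h))))
  have h3' : IsIso ((Mod.forget (D := C) B.X).map
      ((extendScalars f).map ((Mod.comap (homX g)).map h))) := h3
  exact isIso_of_reflects_iso _ (Mod.forget (D := C) B.X)

end

variable {X Y Z : Aff C}

lemma IsAffineOpen.of_isIso (f : Y ⟶ X) [IsIso f] : IsAffineOpen f where
  epi := inferInstance
  flat := flat_of_isIso f.unop
  finitePresentation := isFinitelyPresentable_of_isIso f.unop

lemma IsAffineOpen.comp {f : Z ⟶ Y} {g : Y ⟶ X} (hf : IsAffineOpen f) (hg : IsAffineOpen g) :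
    IsAffineOpen (f ≫ g) where
  epi := have := hf.epi; have := hg.epi; epi_comp g.unop f.unop
  flat := Flat.comp (f := g.unop) (g := f.unop) hg.flat hf.flat
  finitePresentation :=
    have := hg.epi
    isFinitelyPresentable_comp hg.finitePresentation hf.finitePresentation

lemma IsAffineOpen.mono {f : Y ⟶ X} (hf : IsAffineOpen f) : Mono f :=
  have := hf.epi
  inferInstanceAs (Mono f.unop.op)

variable [HasLimits C]

lemma IsAffineOpen.of_isPullback {P : Aff C} {f : Y ⟶ X} {g : Z ⟶ X} {i : P ⟶ Y} {j : P ⟶ Z}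
    (h : IsPullback i j f g) (hf : IsAffineOpen f) : IsAffineOpen j where
  epi := have := hf.epi; MorphismProperty.of_isPushout (P := .epimorphisms _) h.unop hf.epi
  flat := Flat.of_isPushout h.unop.flip hf.flat
  finitePresentation := isFinitelyPresentable_of_isPushout h.unop.flip hf.finitePresentation

lemma IsFlatCover.of_isPullback {I : Type*} {Y P : I → Aff C} {f : ∀ i, Y i ⟶ X} {g : Z ⟶ X}
    {a : ∀ i, P i ⟶ Y i} {b : ∀ i, P i ⟶ Z} (h : ∀ i, IsPullback (a i) (b i) (f i) g)
    (hf : IsFlatCover f) : IsFlatCover b where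
  flat i := Flat.of_isPushout (h i).unop.flip (hf.flat i)
  conservative := by
    obtain ⟨J, hJ⟩ := hf.conservative
    refine ⟨J, fun M N m hm ↦ ?_⟩
    have := hJ ((Mod.comap (homX g.unop)).map m) (fun j hj ↦ by
      have : IsIso ((extendScalars (b j).unop).map m) := hm j hj
      exact isIso_extendScalars_map_of_isPushout (h j).unop.flip m)
    exact isIso_of_isIso_restrict g.unop m

end AffineOpens

end RelSch

namespace RelSch

section Gluing

universe w w' v₁ u₁ v₂ u₂

variable {𝒜 : Type u₁} [Category.{v₁} 𝒜] [HasFiniteLimits 𝒜] {K : Type w} [Finite K]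
  {M : K → 𝒜} {N : K × K → 𝒜} (l : ∀ p : K × K, M p.1 ⟶ N p) (r : ∀ p : K × K, M p.2 ⟶ N p)

/-- The limit of objects `M i` matching in objects `N (i, j)`. -/
noncomputable def gluedObj : 𝒜 :=
  equalizer (Pi.lift fun p ↦ Pi.π M p.1 ≫ l p) (Pi.lift fun p ↦ Pi.π M p.2 ≫ r p)

/-- The inclusion of the glued object in the product. -/
noncomputable def gluedι : gluedObj l r ⟶ ∏ᶜ M := equalizer.ι _ _

/-- The projections of the glued object. -/
noncomputable def gluedπ (i : K) : gluedObj l r ⟶ M i := gluedι l r ≫ Pi.π M i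

lemma gluedπ_condition (p : K × K) : gluedπ l r p.1 ≫ l p = gluedπ l r p.2 ≫ r p := by
  have h := equalizer.condition (Pi.lift fun p ↦ Pi.π M p.1 ≫ l p)
    (Pi.lift fun p ↦ Pi.π M p.2 ≫ r p) =≫ Pi.π N p
  simp only [Category.assoc, Pi.lift_π] at h
  exact (Category.assoc _ _ _).trans (h.trans (Category.assoc _ _ _).symm)

lemma exists_gluedObj_lift {X : 𝒜} (x : ∀ i, X ⟶ M i)
    (hx : ∀ p : K × K, x p.1 ≫ l p = x p.2 ≫ r p) : ∃ y : X ⟶ gluedObj l r, ∀ i, y ≫ gluedπ l r i = x i :=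
  ⟨equalizer.lift (Pi.lift x) (Pi.hom_ext _ _ fun p ↦ by simpa using hx p), fun i ↦
    (equalizer.lift_ι_assoc _ _ _).trans (Pi.lift_π _ _)⟩

variable {ℬ : Type u₂} [Category.{v₂} ℬ] (F : 𝒜 ⥤ ℬ) [PreservesFiniteLimits F]

lemma map_pi_hom_ext {L : Type w'} [Finite L] {P : L → 𝒜} {X : ℬ} {a b : X ⟶ F.obj (∏ᶜ P)}
    (h : ∀ k, a ≫ F.map (Pi.π P k) = b ≫ F.map (Pi.π P k)) : a = b :=
  Fan.IsLimit.hom_ext (isLimitMapConeFanMkEquiv F _ _ (isLimitOfPreserves F (productIsProduct P))) _ _ h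

lemma map_gluedObj_hom_ext {X : ℬ} {a b : X ⟶ F.obj (gluedObj l r)}
    (h : ∀ i, a ≫ F.map (gluedπ l r i) = b ≫ F.map (gluedπ l r i)) : a = b := by
  have : Mono (gluedι l r) := inferInstanceAs (Mono (equalizer.ι _ _))
  rw [← cancel_mono (F.map (gluedι l r))]
  refine map_pi_hom_ext F fun i ↦ ?_
  simpa [gluedπ] using h i

lemma exists_map_gluedObj_lift {X : ℬ} (x : ∀ i, X ⟶ F.obj (M i))
    (hx : ∀ p : K × K, x p.1 ≫ F.map (l p) = x p.2 ≫ F.map (r p)) :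
    ∃ y : X ⟶ F.obj (gluedObj l r), ∀ i, y ≫ F.map (gluedπ l r i) = x i := by
  obtain ⟨y, hy⟩ : ∃ y : X ⟶ F.obj (∏ᶜ M), ∀ i, y ≫ F.map (Pi.π M i) = x i :=
    ⟨Fan.IsLimit.lift (isLimitMapConeFanMkEquiv F _ _ (isLimitOfPreserves F (productIsProduct M))) x,
      fun i ↦ Fan.IsLimit.fac _ _ _⟩
  have hι := isLimitForkMapOfIsLimit F (equalizer.condition
    (Pi.lift fun p ↦ Pi.π M p.1 ≫ l p) (Pi.lift fun p ↦ Pi.π M p.2 ≫ r p))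
    (equalizerIsEqualizer _ _)
  obtain ⟨z, hz⟩ := Fork.IsLimit.lift' hι y (map_pi_hom_ext F fun p ↦ by
      simp only [Category.assoc, ← F.map_comp, Pi.lift_π]
      simp only [F.map_comp, reassoc_of% hy, hx])
  refine ⟨z, fun i ↦ ?_⟩
  rw [← hy, ← hz, gluedπ, F.map_comp]
  exact (Category.assoc _ _ _).symm

end Gluing

section Descent

set_option autoImplicit false

set_option linter.unusedSectionVars false

variable {C : Type u} [Category.{v} C] [MonoidalCategory C] [SymmetricCategory C]
  [MonoidalClosed C] [HasColimits C] {A B D : CommMon C}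

/-- A morphism of commutative `A`-algebras as an `A`-linear map. -/
def algModHom {f : A ⟶ B} {g : A ⟶ D} (h : B ⟶ D) (w : f ≫ h = g) :
    algMod (homX f) ⟶ algMod (homX g) :=
  Mod.Hom.mk' (M := algMod (homX f)) (N := algMod (homX g)) (homX h) (by
    subst w
    change (homX f ▷ B.X ≫ μ) ≫ homX h = A.X ◁ homX h ≫ homX (f ≫ h) ▷ D.X ≫ μ
    rw [Category.assoc, IsMonHom.mul_hom, homX_comp, MonoidalCategory.tensorHom_def,
      whisker_exchange_assoc]
    simp)

lemma tensorUnit_extendMap (f : A ⟶ B) {M N : Mod C A.X} (h : M ⟶ N) :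
    tensorUnit (homX f) M ≫ extendMap f h = h.hom ≫ tensorUnit (homX f) N := by
  simp only [tensorUnit, Category.assoc, tensorπ_extendMap]
  rw [← whisker_exchange_assoc, leftUnitor_inv_naturality_assoc]

lemma extendScalars_hom_ext (f : A ⟶ B) {M : Mod C A.X} {N : Mod C B.X}
    {a b : (extendScalars f).obj M ⟶ N}
    (h : tensorUnit (homX f) M ≫ a.hom = tensorUnit (homX f) M ≫ b.hom) : a = b :=
  (tensorHomEquiv (homX f) M N).injective (Mod.hom_ext _ _ h)

lemma inl_linear (f : A ⟶ B) (M : Mod C A.X) (e : 𝟙_ C ⟶ M.X) :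
    μ ≫ (ρ_ B.X).inv ≫ B.X ◁ e ≫ tensorπ (homX f) M =
      B.X ◁ ((ρ_ B.X).inv ≫ B.X ◁ e ≫ tensorπ (homX f) M) ≫ tensorAct (homX f) M := by
  simp only [MonoidalCategory.whiskerLeft_comp, Category.assoc, tensorπ_act]
  rw [associator_inv_naturality_right_assoc, whisker_exchange_assoc,
    rightUnitor_inv_naturality_assoc]
  simp

/-- The inclusion `B ⟶ B ⊗_A D`, as a `B`-linear map. -/
noncomputable def inlLinear (f : A ⟶ B) (g : A ⟶ D) :
    Mod.regular B.X ⟶ (extendScalars f).obj (algMod (homX g)) :=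
  Mod.Hom.mk' (M := Mod.regular B.X) (N := tensorMod (homX f) (algMod (homX g)))
    (homX (pushoutInl f g)) (by
      have h : homX (pushoutInl f g) = (ρ_ B.X).inv ≫ B.X ◁ η[D.X] ≫ tensorπ (homX f)
        (algMod (homX g)) := Category.assoc _ _ _
      rw [h]
      exact inl_linear f (algMod (homX g)) η[D.X])

/-- The `B`-linear map `B ⊗_A M ⟶ B` induced by an `A`-linear map `M ⟶ B`. -/
noncomputable def toRegular (f : A ⟶ B) {M : Mod C A.X} (h : M ⟶ algMod (homX f)) :
    (extendScalars f).obj M ⟶ Mod.regular B.X :=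
  (tensorHomEquiv (homX f) M (Mod.regular B.X)).symm h

lemma tensorUnit_toRegular (f : A ⟶ B) {M : Mod C A.X} (h : M ⟶ algMod (homX f)) :
    tensorUnit (homX f) M ≫ (toRegular f h).hom = h.hom :=
  tensorUnit_desc (homX f) M (Mod.regular B.X) h.hom h.isModHom.smul_hom

lemma tensorπ_toRegular (f : A ⟶ B) {M : Mod C A.X} (h : M ⟶ algMod (homX f)) :
    tensorπ (homX f) M ≫ (toRegular f h).hom = B.X ◁ h.hom ≫ μ :=
  tensorπ_desc (homX f) M (Mod.regular B.X) h.hom h.isModHom.smul_hom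

lemma map_comp_toRegular (f : A ⟶ B) {M N : Mod C A.X} (h : M ⟶ N) (k : N ⟶ algMod (homX f)) :
    (extendScalars f).map h ≫ toRegular f k = toRegular f (h ≫ k) :=
  extendScalars_hom_ext f ((Category.assoc _ _ _).symm.trans (
    (tensorUnit_extendMap f h =≫ (toRegular f k).hom).trans ((Category.assoc _ _ _).trans (by
      rw [tensorUnit_toRegular, tensorUnit_toRegular]; rfl))))

lemma isIso_toRegular (f : A ⟶ B) :
    IsIso (toRegular f (algModHom (f := 𝟙 A) (g := f) f (Category.id_comp _))) := by
  set t := toRegular f (algModHom (f := 𝟙 A) (g := f) f (Category.id_comp _))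
  have h1 : IsIso (pushoutInl f (𝟙 A)) := (isPushout_pushoutObj f (𝟙 A)).isIso_inl_of_isIso
  have h2 : IsIso (homX (pushoutInl f (𝟙 A))) :=
    ⟨homX (inv (pushoutInl f (𝟙 A))), by rw [← homX_comp, IsIso.hom_inv_id, homX_id],
      by rw [← homX_comp, IsIso.inv_hom_id, homX_id]⟩
  have h3 : homX (pushoutInl f (𝟙 A)) ≫ t.hom = 𝟙 B.X := by
    have h := tensorπ_toRegular f (algModHom (f := 𝟙 A) (g := f) f (Category.id_comp _))
    refine ((Category.assoc (tensorInl B.X A.X) (tensorπ (homX f) (algMod (homX (𝟙 A)))) t.hom).trans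
      (tensorInl B.X A.X ≫= h)).trans ?_
    change ((ρ_ B.X).inv ≫ B.X ◁ η[A.X]) ≫ B.X ◁ homX f ≫ μ = 𝟙 B.X
    rw [Category.assoc, ← MonoidalCategory.whiskerLeft_comp_assoc, IsMonHom.one_hom, MonObj.mul_one,
      Iso.inv_hom_id]
  have h5 : IsIso ((Mod.forget (D := C) B.X).map t) :=
    have : IsIso (homX (pushoutInl f (𝟙 A)) ≫ (Mod.forget (D := C) B.X).map t) :=
      h3.symm ▸ inferInstanceAs (IsIso (𝟙 B.X))
    IsIso.of_isIso_comp_left (homX (pushoutInl f (𝟙 A))) _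
  exact isIso_of_reflects_iso t (Mod.forget (D := C) B.X)

instance [HasLimits C] : HasFiniteLimits (Mod C A.X) := ⟨fun _ _ _ ↦ inferInstance⟩

variable [HasLimits C] {K : Type*} [Finite K] {B : K → CommMon C} (f : ∀ i, A ⟶ B i)

/-- The maps `B i ⟶ B i ⊗_A B j` as `A`-linear maps. -/
noncomputable def descentInl (p : K × K) : algMod (homX (f p.1)) ⟶
    algMod (homX (f p.1 ≫ pushoutInl (f p.1) (f p.2))) :=
  algModHom (pushoutInl (f p.1) (f p.2)) rfl

/-- The maps `B j ⟶ B i ⊗_A B j` as `A`-linear maps. -/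
noncomputable def descentInr (p : K × K) : algMod (homX (f p.2)) ⟶
    algMod (homX (f p.1 ≫ pushoutInl (f p.1) (f p.2))) :=
  algModHom (pushoutInr (f p.1) (f p.2)) (pushout_condition _ _).symm

/-- The limit of the algebras `B i` over the algebras `B i ⊗_A B j`. -/
noncomputable def descentObj : Mod C A.X :=
  gluedObj (M := fun i ↦ algMod (homX (f i)))
    (N := fun p ↦ algMod (homX (f p.1 ≫ pushoutInl (f p.1) (f p.2)))) (descentInl f) (descentInr f)

/-- The projections of `descentObj`. -/
noncomputable def descentπ (i : K) : descentObj f ⟶ algMod (homX (f i)) :=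
  gluedπ (M := fun i ↦ algMod (homX (f i)))
    (N := fun p ↦ algMod (homX (f p.1 ≫ pushoutInl (f p.1) (f p.2)))) (descentInl f) (descentInr f) i

/-- The morphisms in `C` underlying the projections of `descentObj`. -/
noncomputable def descentHomX (i : K) : (descentObj f).X ⟶ (B i).X := (descentπ f i).hom

lemma descentπ_condition (i j : K) : descentHomX f i ≫ homX (pushoutInl (f i) (f j)) =
    descentHomX f j ≫ homX (pushoutInr (f i) (f j)) :=
  congr(($(gluedπ_condition (M := fun i ↦ algMod (homX (f i)))
    (N := fun p ↦ algMod (homX (f p.1 ≫ pushoutInl (f p.1) (f p.2))))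
    (descentInl f) (descentInr f) (i, j))).hom)

lemma extendScalars_map_descentπ (k i : K) :
    (extendScalars (f k)).map (descentπ f i) =
      toRegular (f k) (descentπ f k) ≫ inlLinear (f k) (f i) := by
  apply extendScalars_hom_ext
  refine (tensorUnit_extendMap (f k) _).trans ?_
  refine .trans ?_ (((tensorUnit_toRegular (f k) (descentπ f k)) =≫
    homX (pushoutInl (f k) (f i))).symm.trans (Category.assoc _ _ _))
  refine Eq.trans ?_ (descentπ_condition f k i).symm
  rw [homX_pushoutInr_eq]
  rfl

lemma exists_descent_iso (hf : ∀ i, Flat (f i))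
    (hc : ∀ ⦃M N : Mod C A.X⦄ (g : M ⟶ N), (∀ i, IsIso ((extendScalars (f i)).map g)) → IsIso g) :
    ∃ u : algMod (homX (𝟙 A)) ⟶ descentObj f, IsIso u ∧
      ∀ i, u ≫ descentπ f i = algModHom (f i) (Category.id_comp _) := by
  obtain ⟨u, hu⟩ : ∃ u : algMod (homX (𝟙 A)) ⟶ descentObj f,
      ∀ i, u ≫ descentπ f i = algModHom (f i) (Category.id_comp _) :=
    exists_gluedObj_lift (M := fun i ↦ algMod (homX (f i)))
      (N := fun p ↦ algMod (homX (f p.1 ≫ pushoutInl (f p.1) (f p.2)))) (descentInl f) (descentInr f)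
      (fun i ↦ algModHom (f := 𝟙 A) (f i) (Category.id_comp _))
      (fun p ↦ Mod.hom_ext _ _ congr(homX $(pushout_condition (f p.1) (f p.2))))
  refine ⟨u, hc u fun k ↦ ?_, hu⟩
  have : PreservesFiniteLimits (extendScalars (f k)) := hf k
  have hm : Mono (toRegular (f k) (descentπ f k)) :=
    ⟨fun a b h ↦ map_gluedObj_hom_ext _ _ (extendScalars (f k)) fun i ↦ by
      have := extendScalars_map_descentπ f k i
      refine (a ≫= this).trans (Eq.trans ?_ (b ≫= this).symm)
      rw [reassoc_of% h]⟩
  have h1 := map_comp_toRegular (f k) u (descentπ f k)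
  rw [hu] at h1
  have h2 := isIso_toRegular (f k)
  rw [← h1] at h2
  have : IsIso (toRegular (f k) (descentπ f k)) := by
    have : IsSplitEpi (toRegular (f k) (descentπ f k)) :=
      ⟨⟨inv ((extendScalars (f k)).map u ≫ toRegular (f k) (descentπ f k)) ≫
        (extendScalars (f k)).map u, by rw [Category.assoc, IsIso.inv_hom_id]⟩⟩
    exact isIso_of_mono_of_isSplitEpi _
  exact IsIso.of_isIso_comp_right _ (toRegular (f k) (descentπ f k))

lemma descentObj_hom_ext {X : C} {a b : X ⟶ (descentObj f).X}
    (h : ∀ i, a ≫ descentHomX f i = b ≫ descentHomX f i) : a = b :=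
  have : PreservesFiniteLimits (Mod.forget (D := C) A.X) := ⟨fun _ _ _ ↦ inferInstance⟩
  map_gluedObj_hom_ext (M := fun i ↦ algMod (homX (f i)))
    (N := fun p ↦ algMod (homX (f p.1 ≫ pushoutInl (f p.1) (f p.2)))) (descentInl f) (descentInr f)
    (Mod.forget (D := C) A.X) h

lemma exists_descentObj_lift {X : C} (x : ∀ i, X ⟶ (B i).X)
    (hx : ∀ i j, x i ≫ homX (pushoutInl (f i) (f j)) = x j ≫ homX (pushoutInr (f i) (f j))) :
    ∃ y : X ⟶ (descentObj f).X, ∀ i, y ≫ descentHomX f i = x i :=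
  have : PreservesFiniteLimits (Mod.forget (D := C) A.X) := ⟨fun _ _ _ ↦ inferInstance⟩
  exists_map_gluedObj_lift (M := fun i ↦ algMod (homX (f i)))
    (N := fun p ↦ algMod (homX (f p.1 ≫ pushoutInl (f p.1) (f p.2)))) (descentInl f) (descentInr f)
    (Mod.forget (D := C) A.X) x (fun p ↦ hx p.1 p.2)

lemma existsUnique_descent (hf : ∀ i, Flat (f i))
    (hc : ∀ ⦃M N : Mod C A.X⦄ (g : M ⟶ N), (∀ i, IsIso ((extendScalars (f i)).map g)) → IsIso g)
    (x : ∀ i, D ⟶ B i)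
    (hx : ∀ i j, x i ≫ pushoutInl (f i) (f j) = x j ≫ pushoutInr (f i) (f j)) :
    ∃! y : D ⟶ A, ∀ i, y ≫ f i = x i := by
  obtain ⟨u, hu, hu'⟩ := exists_descent_iso f hf hc
  obtain ⟨t, ht, huX⟩ : ∃ t : A.X ⟶ (descentObj f).X, (∀ i, t ≫ descentHomX f i = homX (f i)) ∧
      IsIso t := ⟨u.hom, fun i ↦ congr(Mod.Hom.hom $(hu' i)),
        inferInstanceAs (IsIso ((Mod.forget (D := C) A.X).map u))⟩
  have ext {X : C} (a b : X ⟶ A.X) (h : ∀ i, a ≫ homX (f i) = b ≫ homX (f i)) : a = b := by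
    rw [← cancel_mono t]
    exact descentObj_hom_ext f fun i ↦ by rw [Category.assoc, Category.assoc, ht, h]
  obtain ⟨z, hz⟩ := exists_descentObj_lift f (X := D.X) (fun i ↦ homX (x i))
    (fun i j ↦ congr(homX $(hx i j)))
  obtain ⟨y, rfl⟩ : ∃ y : D.X ⟶ A.X, y ≫ t = z := ⟨z ≫ inv t, by simp⟩
  have hy (i) : y ≫ homX (f i) = homX (x i) := by
    rw [← ht i, ← hz, Category.assoc]
  have : IsMonHom y :=
    { one_hom := ext _ _ fun i ↦ by rw [Category.assoc, hy, IsMonHom.one_hom, IsMonHom.one_hom]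
      mul_hom := ext _ _ fun i ↦ by
        rw [Category.assoc, Category.assoc, hy, IsMonHom.mul_hom, IsMonHom.mul_hom, ← hy i,
          ← tensorHom_comp_tensorHom_assoc] }
  exact ⟨ofHomX y, fun i ↦ homX_injective (hy i), fun y' hy' ↦ homX_injective
    (ext _ _ fun i ↦ (congr(homX $(hy' i))).trans (hy i).symm)⟩

end Descent

end RelSch

namespace RelSch

section Topology

set_option linter.unusedSectionVars false

variable {C : Type u} [Category.{v} C] [MonoidalCategory C] [SymmetricCategory C]
  [MonoidalClosed C] [HasColimits C] {X Z : Aff C}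

lemma IsFlatCover.exists_finset {I : Type*} {Y : I → Aff C} {f : ∀ i, Y i ⟶ X} (hf : IsFlatCover f) :
    ∃ J : Finset I, IsFlatCover (fun j : J ↦ f j) := by
  obtain ⟨J, hJ⟩ := hf.conservative
  exact ⟨J, fun j ↦ hf.flat j, Finset.univ, fun M N g hg ↦
    hJ g fun j hj ↦ hg ⟨j, hj⟩ (Finset.mem_univ _)⟩

/-- The Zariski opens of affine schemes which belong to a sieve. -/
def affineOpens (S : Sieve X) : Presieve X := fun _ f ↦ IsAffineOpen f ∧ S f

variable [HasLimits C]

lemma IsFlatCover.isSheafFor {K : Type*} [Finite K] {Y : K → Aff C} {f : ∀ i, Y i ⟶ X}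
    (hf : IsFlatCover f) (D : Aff C) : (Presieve.ofArrows Y f).IsSheafFor (yoneda.obj D) := by
  rw [Presieve.isSheafFor_arrows_iff]
  intro x hx
  obtain ⟨y, hy, hy'⟩ := existsUnique_descent (fun i ↦ (f i).unop) hf.flat
    (fun M N g hg ↦ by
      obtain ⟨J, hJ⟩ := hf.conservative
      exact hJ g fun j _ ↦ hg j)
    (D := D.unop) (fun i ↦ (x i).unop) (fun i j ↦ by
      have h := hx i j (op (pushoutObj (f i).unop (f j).unop))
        (pushoutInl (f i).unop (f j).unop).op (pushoutInr (f i).unop (f j).unop).op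
        (Quiver.Hom.unop_inj (pushout_condition (f i).unop (f j).unop))
      exact congr(Quiver.Hom.unop $h))
  exact ⟨y.op, fun i ↦ Quiver.Hom.unop_inj (hy i), fun z hz ↦ Quiver.Hom.unop_inj
    (hy' z.unop fun i ↦ congr(Quiver.Hom.unop $(hz i)))⟩

lemma IsFlatCover.isSheafFor_pullback {K : Type*} [Finite K] {Y : K → Aff C} {f : ∀ i, Y i ⟶ X}
    (hf : IsFlatCover f) (D : Aff C) (g : Z ⟶ X) :
    Presieve.IsSheafFor (yoneda.obj D)
      ((Sieve.generate (Presieve.ofArrows Y f)).pullback g).arrows := by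
  rw [← Sieve.pullbackArrows_comm, ← Presieve.isSheafFor_iff_generate, ← Presieve.ofArrows_pullback]
  exact (hf.of_isPullback (fun i ↦ IsPullback.of_hasPullback (f i) g)).isSheafFor D

instance : (zariskiTopology C).Subcanonical :=
  .of_isSheaf_yoneda_obj _ fun D ↦ (Precoverage.isSheaf_toGrothendieck_iff _).2 (by
    rintro X Z g _ ⟨I, Y, f, hf, rfl⟩
    obtain ⟨J, hJ⟩ := hf.flatCover.exists_finset
    refine Presieve.isSheafFor_subsieve _
      (S := (Sieve.generate (Presieve.ofArrows _ fun j : J ↦ f j)).pullback g) ?_ fun W h ↦ ?_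
    · refine Sieve.pullback_monotone g (Sieve.generate_mono ?_)
      rintro _ _ ⟨j⟩
      exact ⟨_⟩
    · rw [← Sieve.pullback_comp]
      exact hJ.isSheafFor_pullback D _)

lemma pullback_generate_affineOpens_le (S : Sieve X) (f : Z ⟶ X) :
    (Sieve.generate (affineOpens S)).pullback f ≤ Sieve.generate (affineOpens (S.pullback f)) := by
  rintro W g ⟨U, a, b, ⟨hb, hb'⟩, h⟩
  refine ⟨pullback b f, pullback.lift a g h, pullback.snd b f,
    ⟨hb.of_isPullback (IsPullback.of_hasPullback b f), ?_⟩, pullback.lift_snd _ _ _⟩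
  rw [Sieve.pullback_apply, ← pullback.condition]
  exact S.downward_closed hb' _

lemma generate_affineOpens_pullback_le (S : Sieve X) {f : Z ⟶ X} (hf : IsAffineOpen f) :
    Sieve.generate (affineOpens (S.pullback f)) ≤ (Sieve.generate (affineOpens S)).pullback f := by
  rintro W g ⟨U, a, b, ⟨hb, hb'⟩, rfl⟩
  exact ⟨U, a, b ≫ f, ⟨hb.comp hf, hb'⟩, (Category.assoc _ _ _).symm⟩

/-- A covering sieve is generated, up to refinement, by Zariski opens. -/
lemma generate_affineOpens_mem {S : Sieve X} (hS : S ∈ zariskiTopology C X) :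
    Sieve.generate (affineOpens S) ∈ zariskiTopology C X := by
  change (zariskiPrecoverage C).Saturate X S at hS
  induction hS with
  | of X R hR =>
    refine GrothendieckTopology.superset_covering _ (Sieve.generate_mono ?_)
      (Precoverage.generate_mem_toGrothendieck hR)
    obtain ⟨I, Y, f, hf, rfl⟩ := hR
    rintro _ _ ⟨i⟩
    exact ⟨hf.isOpen i, Sieve.le_generate _ _ _ ⟨i⟩⟩
  | top X =>
    refine GrothendieckTopology.superset_covering _ ?_ (GrothendieckTopology.top_mem _ X)
    exact fun Y f _ ↦ ⟨X, f, 𝟙 X, ⟨.of_isIso _, trivial⟩, Category.comp_id _⟩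
  | pullback X S _ Y f ih =>
    exact GrothendieckTopology.superset_covering _ (pullback_generate_affineOpens_le S f)
      (GrothendieckTopology.pullback_stable _ f ih)
  | transitive X S R _ _ ihS ihR =>
    refine GrothendieckTopology.transitive _ ihS _ ?_
    rintro Y _ ⟨Z, a, b, ⟨hb, hb'⟩, rfl⟩
    rw [Sieve.pullback_comp]
    exact GrothendieckTopology.pullback_stable _ a (GrothendieckTopology.superset_covering _
      (generate_affineOpens_pullback_le R hb) (ihR hb'))

end Topology

end RelSch

namespace RelSch

section Sheaves

set_option linter.unusedSectionVars false

variable {C : Type u} [Category.{v} C] [MonoidalCategory C] [SymmetricCategory C]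
  [MonoidalClosed C] [HasColimits C] [HasLimits C]

variable (C) in
/-- The embedding of affine schemes in sheaves. -/
noncomputable def spec : Aff C ⥤ Sh C :=
  GrothendieckTopology.uliftYoneda.{u} (zariskiTopology C)

instance : (spec C).Full := inferInstanceAs (GrothendieckTopology.uliftYoneda.{u} _).Full

instance : (spec C).Faithful := inferInstanceAs (GrothendieckTopology.uliftYoneda.{u} _).Faithful

/-- Morphisms from an affine scheme are sections. -/
noncomputable def specEquiv {A : Aff C} {F : Sh C} : ((spec C).obj A ⟶ F) ≃ F.obj.obj (op A) :=
  GrothendieckTopology.uliftYonedaEquiv.{u} (zariskiTopology C)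

lemma specEquiv_comp {A : Aff C} {F G : Sh C} (x : (spec C).obj A ⟶ F) (f : F ⟶ G) :
    specEquiv (x ≫ f) = f.hom.app _ (specEquiv x) := rfl

lemma specEquiv_map {A B : Aff C} {F : Sh C} (t : B ⟶ A) (x : (spec C).obj A ⟶ F) :
    specEquiv ((spec C).map t ≫ x) = F.obj.map t.op (specEquiv x) :=
  (GrothendieckTopology.uliftYonedaEquiv_naturality (zariskiTopology C) x t).symm

lemma hom_ext_spec {F G : Sh C} {f g : F ⟶ G}
    (h : ∀ (A : Aff C) (x : (spec C).obj A ⟶ F), x ≫ f = x ≫ g) : f = g :=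
  GrothendieckTopology.hom_ext_uliftYoneda (zariskiTopology C) h

lemma mono_of_spec {F G : Sh C} {f : F ⟶ G}
    (h : ∀ (A : Aff C) (x y : (spec C).obj A ⟶ F), x ≫ f = y ≫ f → x = y) : Mono f :=
  ⟨fun a b hab ↦ hom_ext_spec fun A x ↦ h A _ _ (by rw [Category.assoc, Category.assoc, hab])⟩

lemma spec_hom_ext {A : Aff C} {F : Sh C} {x y : (spec C).obj A ⟶ F} {S : Sieve A}
    (hS : S ∈ zariskiTopology C A)
    (h : ∀ ⦃B : Aff C⦄ (t : B ⟶ A), S t → (spec C).map t ≫ x = (spec C).map t ≫ y) : x = y :=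
  specEquiv.injective (((isSheaf_iff_isSheaf_of_type _ _).1 F.property S hS).isSeparatedFor.ext
    fun B t ht ↦ by rw [← specEquiv_map, ← specEquiv_map, h t ht])

/-- The sieve of the morphisms along which a section of `G` lifts to one of the sheaves `F i`. -/
def coverSieve {I : Type*} {F : I → Sh C} {G : Sh C} (f : ∀ i, F i ⟶ G) {A : Aff C}
    (z : (spec C).obj A ⟶ G) : Sieve A where
  arrows B t := ∃ (i : I) (w : (spec C).obj B ⟶ F i), w ≫ f i = (spec C).map t ≫ z
  downward_closed := by
    rintro B D t ⟨i, w, hw⟩ s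
    exact ⟨i, (spec C).map s ≫ w, by rw [Category.assoc, hw, Functor.map_comp, Category.assoc]⟩

/-- A family of morphisms of sheaves is covering if it is jointly locally surjective. -/
def JointlySurjective {I : Type*} {F : I → Sh C} {G : Sh C} (f : ∀ i, F i ⟶ G) : Prop :=
  ∀ ⦃A : Aff C⦄ (z : (spec C).obj A ⟶ G), coverSieve f z ∈ zariskiTopology C A

lemma JointlySurjective.hom_ext {I : Type*} {F : I → Sh C} {G H : Sh C} {f : ∀ i, F i ⟶ G}
    (hf : JointlySurjective f) {a b : G ⟶ H} (h : ∀ i, f i ≫ a = f i ≫ b) : a = b :=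
  hom_ext_spec fun A x ↦ spec_hom_ext (hf x) (by
    rintro B t ⟨i, w, hw⟩
    rw [← reassoc_of% hw, ← reassoc_of% hw, h])

lemma JointlySurjective.epi {I : Type (max u v)} {F : I → Sh C} {G : Sh C} {f : ∀ i, F i ⟶ G}
    (hf : JointlySurjective f) : Epi (Limits.Sigma.desc f) :=
  ⟨fun a b hab ↦ hf.hom_ext fun i ↦ by
    simpa using Limits.Sigma.ι F i ≫= hab⟩

/-- The subsheaf of the sections which lift locally to one of the sheaves `F i`. -/
def jointImage {I : Type*} {F : I → Sh C} {G : Sh C} (f : ∀ i, F i ⟶ G) : Subfunctor G.obj :=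
  (⨆ i, Subfunctor.range (f i).hom).sheafify (zariskiTopology C)

lemma jointlySurjective_of_epi {I : Type (max u v)} {F : I → Sh C} {G : Sh C} (f : ∀ i, F i ⟶ G)
    [Epi (Limits.Sigma.desc f)] : JointlySurjective f := by
  have hG := (isSheaf_iff_isSheaf_of_type _ _).1 G.property
  let T : Sh C := ⟨(jointImage f).toFunctor,
    (isSheaf_iff_isSheaf_of_type _ _).2 (Subfunctor.sheafify_isSheaf _ hG)⟩
  let i : T ⟶ G := ⟨(jointImage f).ι⟩
  have : Mono i := (sheafToPresheaf _ _).mono_of_mono_map (inferInstanceAs (Mono (jointImage f).ι))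
  have hle (k) : Subfunctor.range (f k).hom ≤ jointImage f :=
    (le_iSup (fun i ↦ Subfunctor.range (f i).hom) k).trans (Subfunctor.le_sheafify _ _)
  let g (k : I) : F k ⟶ T := ⟨Subfunctor.lift (f k).hom (hle k)⟩
  have hg (k) : g k ≫ i = f k := rfl
  have : Epi (Limits.Sigma.desc g ≫ i) := by
    have : Limits.Sigma.desc g ≫ i = Limits.Sigma.desc f := by ext k : 1; simp [hg]
    rw [this]; infer_instance
  have : Epi i := epi_of_epi (Limits.Sigma.desc g) i
  have : IsIso i := isIso_of_mono_of_epi i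
  intro A z
  have hz : specEquiv (z ≫ inv i ≫ i) = specEquiv z := by simp
  have hmem : specEquiv z ∈ (jointImage f).obj (op A) := by
    rw [← hz]
    exact (specEquiv (z ≫ inv i)).2
  refine GrothendieckTopology.superset_covering _ ?_ hmem
  intro B t ht
  obtain ⟨k, hk⟩ : ∃ k, G.obj.map t.op (specEquiv z) ∈ (Subfunctor.range (f k).hom).obj (op B) := by
    simpa [Subfunctor.sieveOfSection] using ht
  obtain ⟨y, hy⟩ := hk
  refine ⟨k, specEquiv.symm y, specEquiv.injective ?_⟩
  rw [specEquiv_comp, Equiv.apply_symm_apply, specEquiv_map]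
  exact hy

lemma jointlySurjective_iff_epi {I : Type (max u v)} {F : I → Sh C} {G : Sh C} (f : ∀ i, F i ⟶ G) :
    JointlySurjective f ↔ Epi (Limits.Sigma.desc f) :=
  ⟨fun h ↦ h.epi, fun _ ↦ jointlySurjective_of_epi f⟩

end Sheaves

end RelSch

namespace RelSch

section OpenSieves

set_option linter.unusedSectionVars false

variable {C : Type u} [Category.{v} C] [MonoidalCategory C] [SymmetricCategory C]
  [MonoidalClosed C] [HasColimits C] [HasLimits C] {X Z : Aff C}

/-- A sieve is open if its members factor locally through Zariski opens in the sieve. -/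
def IsOpenSieve (S : Sieve X) : Prop :=
  ∀ ⦃Y : Aff C⦄ (t : Y ⟶ X), S t →
    (Sieve.generate (affineOpens S)).pullback t ∈ zariskiTopology C Y

lemma IsOpenSieve.pullback {S : Sieve X} (hS : IsOpenSieve S) (f : Z ⟶ X) :
    IsOpenSieve (S.pullback f) := fun Y t ht ↦ by
  refine GrothendieckTopology.superset_covering _
    (Sieve.pullback_monotone t (pullback_generate_affineOpens_le S f)) ?_
  rw [← Sieve.pullback_comp]
  exact hS _ ht

lemma isOpenSieve_top : IsOpenSieve (⊤ : Sieve X) := fun _ t _ ↦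
  GrothendieckTopology.pullback_stable _ t
    (generate_affineOpens_mem (GrothendieckTopology.top_mem _ X))

lemma isOpenSieve_of_bot_mem {S : Sieve X}
    (h : ∀ ⦃Y : Aff C⦄ (t : Y ⟶ X), S t → ⊥ ∈ zariskiTopology C Y) : IsOpenSieve S :=
  fun _ t ht ↦ GrothendieckTopology.superset_covering _ bot_le (h t ht)

lemma isOpenSieve_of_affineOpens {S R : Sieve X}
    (h : ∀ ⦃Y : Aff C⦄ (t : Y ⟶ X), S t →
      (Sieve.generate (affineOpens R)).pullback t ∈ zariskiTopology C Y)
    (hR : ∀ ⦃Y : Aff C⦄ (f : Y ⟶ X), R f → IsOpenSieve (S.pullback f)) : IsOpenSieve S := by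
  intro Y t ht
  refine GrothendieckTopology.transitive _ (h t ht) _ ?_
  rintro W s ⟨U, a, b, ⟨hb, hb'⟩, hab⟩
  rw [← Sieve.pullback_comp, ← hab, Sieve.pullback_comp]
  refine GrothendieckTopology.superset_covering _
    (Sieve.pullback_monotone a (generate_affineOpens_pullback_le S hb)) (hR b hb' a ?_)
  rw [Sieve.pullback_apply, hab]
  exact S.downward_closed ht s

lemma isOpenSieve_of_cover {S R : Sieve X} (hR : R ∈ zariskiTopology C X)
    (h : ∀ ⦃Y : Aff C⦄ (f : Y ⟶ X), R f → IsOpenSieve (S.pullback f)) : IsOpenSieve S :=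
  isOpenSieve_of_affineOpens
    (fun _ t _ ↦ GrothendieckTopology.pullback_stable _ t (generate_affineOpens_mem hR)) h

lemma IsOpenSieve.inf {S R : Sieve X} (hS : IsOpenSieve S) (hR : IsOpenSieve R) :
    IsOpenSieve (S ⊓ R) := by
  refine isOpenSieve_of_affineOpens (R := S) (fun Y t ht ↦ hS t ht.1) fun Y f hf ↦ ?_
  have : (S ⊓ R).pullback f = R.pullback f := by
    rw [Sieve.pullback_inter, (Sieve.mem_iff_pullback_eq_top f).1 hf, top_inf_eq]
  rw [this]
  exact hR.pullback f

end OpenSieves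

section OpenInclusions

set_option linter.unusedSectionVars false

variable {C : Type u} [Category.{v} C] [MonoidalCategory C] [SymmetricCategory C]
  [MonoidalClosed C] [HasColimits C] [HasLimits C] {F G H : Sh C}

/-- The sieve of the morphisms along which a section of `G` lifts to `F`. -/
def liftSieve (f : F ⟶ G) {A : Aff C} (z : (spec C).obj A ⟶ G) : Sieve A where
  arrows B t := ∃ w : (spec C).obj B ⟶ F, w ≫ f = (spec C).map t ≫ z
  downward_closed := by
    rintro B D t ⟨w, hw⟩ s
    exact ⟨(spec C).map s ≫ w, by rw [Category.assoc, hw, Functor.map_comp, Category.assoc]⟩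

lemma liftSieve_pullback (f : F ⟶ G) {A B : Aff C} (z : (spec C).obj A ⟶ G) (t : B ⟶ A) :
    (liftSieve f z).pullback t = liftSieve f ((spec C).map t ≫ z) := by
  ext D s
  change (∃ w, _) ↔ ∃ w, _
  simp only [Functor.map_comp, Category.assoc]

/-- A monomorphism of sheaves along which sections lift on open sieves. -/
structure IsOpenInclusion (f : F ⟶ G) : Prop where
  mono : Mono f
  isOpenSieve : ∀ ⦃A : Aff C⦄ (z : (spec C).obj A ⟶ G), IsOpenSieve (liftSieve f z)

lemma IsOpenInclusion.of_isIso (f : F ⟶ G) [IsIso f] : IsOpenInclusion f where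
  mono := inferInstance
  isOpenSieve A z := by
    have : liftSieve f z = ⊤ := by
      ext B t
      exact ⟨fun _ ↦ trivial, fun _ ↦ ⟨(spec C).map t ≫ z ≫ inv f, by simp⟩⟩
    rw [this]
    exact isOpenSieve_top

lemma IsOpenInclusion.comp {f : F ⟶ G} {g : G ⟶ H} (hf : IsOpenInclusion f)
    (hg : IsOpenInclusion g) : IsOpenInclusion (f ≫ g) where
  mono := have := hf.mono; have := hg.mono; mono_comp f g
  isOpenSieve A z := by
    have := hg.mono
    refine isOpenSieve_of_affineOpens (R := liftSieve g z) ?_ ?_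
    · rintro Y t ⟨w, hw⟩
      exact hg.isOpenSieve z t ⟨w ≫ f, by rw [Category.assoc, hw]⟩
    · rintro Y t ⟨w, hw⟩
      have h : (liftSieve (f ≫ g) z).pullback t = liftSieve f w := by
        rw [liftSieve_pullback, ← hw]
        ext D s
        change (∃ x, _) ↔ ∃ x, _
        simp only [← Category.assoc, cancel_mono]
      rw [h]
      exact hf.isOpenSieve w

lemma IsOpenInclusion.of_lift_iff {F' G' : Sh C} {f : F ⟶ G} (hf : IsOpenInclusion f) {f' : F' ⟶ G'}
    (g : G' ⟶ G) (hf' : Mono f') (h : ∀ (A : Aff C) (z : (spec C).obj A ⟶ G'),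
      (∃ w : (spec C).obj A ⟶ F', w ≫ f' = z) ↔ ∃ w : (spec C).obj A ⟶ F, w ≫ f = z ≫ g) :
    IsOpenInclusion f' where
  mono := hf'
  isOpenSieve A z := by
    have : liftSieve f' z = liftSieve f (z ≫ g) := by
      ext B t
      exact (h B _).trans (by rw [Category.assoc]; rfl)
    rw [this]
    exact hf.isOpenSieve _

lemma isAffineOpenMap_spec {B A : Aff C} {b : B ⟶ A} (hb : IsAffineOpen b) {X : Sh C}
    (e : (spec C).obj A ≅ X) : IsAffineOpenMap ((spec C).map b ≫ e.hom) :=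
  ⟨B, A, b, hb, ⟨Arrow.isoMk (Iso.refl _) ((sheafToPresheaf _ _).mapIso e)
    (Category.id_comp _)⟩⟩

lemma IsAffine.exists_iso {X : Sh C} (hX : IsAffine X) : ∃ A : Aff C, Nonempty ((spec C).obj A ≅ X) := by
  obtain ⟨A, ⟨e⟩⟩ := hX
  exact ⟨A, ⟨(fullyFaithfulSheafToPresheaf _ _).preimageIso e⟩⟩

lemma isAffine_of_iso {X : Sh C} {A : Aff C} (e : (spec C).obj A ≅ X) : IsAffine X :=
  ⟨A, ⟨(sheafToPresheaf _ _).mapIso e⟩⟩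

lemma IsAffineOpenMap.exists_iso {Y : Sh C} {A : Aff C} {g : Y ⟶ (spec C).obj A}
    (hg : IsAffineOpenMap g) : ∃ (B : Aff C) (b : B ⟶ A) (e : (spec C).obj B ≅ Y),
      IsAffineOpen b ∧ e.hom ≫ g = (spec C).map b := by
  obtain ⟨B, A', f, hf, ⟨i⟩⟩ := hg
  let l : (spec C).obj B ≅ Y := (fullyFaithfulSheafToPresheaf _ _).preimageIso (Arrow.leftFunc.mapIso i)
  let r' : (spec C).obj A' ≅ (spec C).obj A :=
    (fullyFaithfulSheafToPresheaf _ _).preimageIso (Arrow.rightFunc.mapIso i)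
  let r : A' ≅ A := (spec C).preimageIso r'
  have h : l.hom ≫ g = (spec C).map f ≫ r'.hom :=
    (sheafToPresheaf _ _).map_injective (Arrow.w i.hom)
  refine ⟨B, f ≫ r.hom, l, hf.comp (.of_isIso r.hom), ?_⟩
  rw [h, Functor.map_comp]
  simp [r]

lemma imageSubobject_comp_of_epi (h : F ⟶ G) [Epi h] (f : G ⟶ H) :
    imageSubobject (h ≫ f) = imageSubobject f := by
  have := imageSubobject_comp_le_epi_of_epi h f
  have : IsIso (Subobject.ofLE _ _ (imageSubobject_comp_le h f)) := isIso_of_mono_of_epi _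
  refine le_antisymm (imageSubobject_comp_le _ _) (Subobject.le_of_comm
    (inv (Subobject.ofLE _ _ (imageSubobject_comp_le h f))) ?_)
  rw [IsIso.inv_comp_eq, Subobject.ofLE_arrow]

lemma mk_factors_iff_exists {𝒜 : Type*} [Category* 𝒜] {X Y T : 𝒜} (f : X ⟶ Y) [Mono f] (g : T ⟶ Y) :
    (Subobject.mk f).Factors g ↔ ∃ w : T ⟶ X, w ≫ f = g := Iff.rfl

lemma IsOpenInclusion.isZariskiOpen {f : F ⟶ G} (hf : IsOpenInclusion f) : IsZariskiOpen f := by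
  intro X hX x
  have := hf.mono
  refine ⟨inferInstance, ?_⟩
  obtain ⟨A, ⟨e⟩⟩ := hX.exists_iso
  let S := liftSieve f (e.hom ≫ x)
  let I : Type (max u v) := Σ B : Aff C, {b : B ⟶ A // IsAffineOpen b ∧ S b}
  have hl (k : I) : ∃ l : (spec C).obj k.1 ⟶ pullback f x,
      l ≫ pullback.snd f x = (spec C).map k.2.1 ≫ e.hom := by
    obtain ⟨B, b, hb, w, hw⟩ := k
    exact ⟨pullback.lift w ((spec C).map b ≫ e.hom) (by rw [hw, Category.assoc]),
      pullback.lift_snd _ _ _⟩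
  choose l hl using hl
  refine ⟨I, fun k ↦ (spec C).obj k.1, fun k ↦ (spec C).map k.2.1 ≫ e.hom,
    fun k ↦ isAffineOpenMap_spec k.2.2.1 e, ?_⟩
  have hs : JointlySurjective l := by
    intro D z
    obtain ⟨t, ht⟩ := (spec C).map_surjective (z ≫ pullback.snd f x ≫ e.inv)
    have ht' : z ≫ pullback.snd f x = (spec C).map t ≫ e.hom := by simp [ht]
    have hS : S t := ⟨z ≫ pullback.fst f x, by
      rw [Category.assoc, pullback.condition, reassoc_of% ht']⟩
    refine GrothendieckTopology.superset_covering _ ?_ (hf.isOpenSieve (e.hom ≫ x) t hS)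
    rintro E s ⟨U, a, b, hb, hab⟩
    refine ⟨⟨U, b, hb⟩, (spec C).map a, ?_⟩
    rw [← cancel_mono (pullback.snd f x), Category.assoc, hl, Category.assoc, ht',
      ← Functor.map_comp_assoc, ← Functor.map_comp_assoc, hab]
  have := hs.epi
  have hd : Limits.Sigma.desc (fun k : I ↦ (spec C).map k.2.1 ≫ e.hom) =
      Limits.Sigma.desc l ≫ pullback.snd f x := by
    ext k : 1
    simp [hl]
  have key (d : (∐ fun k : I ↦ (spec C).obj k.1) ⟶ X) (hd : d = Limits.Sigma.desc l ≫ pullback.snd f x) :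
      imageSubobject (pullback.snd f x) = imageSubobject d := by
    subst hd
    exact (imageSubobject_comp_of_epi _ _).symm
  exact key _ hd

lemma isOpenInclusion_of_isZariskiOpen {f : F ⟶ G} (hf : IsZariskiOpen f) : IsOpenInclusion f where
  mono := mono_of_spec fun A x y hxy ↦ by
    have := (hf ((spec C).obj A) (isAffine_of_iso (Iso.refl _)) (x ≫ f)).1
    have h : pullback.lift x (𝟙 _) (Category.id_comp _).symm =
        pullback.lift (f := f) (g := x ≫ f) y (𝟙 _) (by rw [hxy, Category.id_comp]) := by
      rw [← cancel_mono (pullback.snd f (x ≫ f)), pullback.lift_snd, pullback.lift_snd]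
    exact (pullback.lift_fst _ _ _).symm.trans
      ((h =≫ pullback.fst f (x ≫ f)).trans (pullback.lift_fst _ _ _))
  isOpenSieve A z := by
    obtain ⟨hm, I, Y, g, hg, hF⟩ := hf ((spec C).obj A) (isAffine_of_iso (Iso.refl _)) z
    choose B b e hb hbe using fun i ↦ (hg i).exists_iso
    have hlift {D : Aff C} (t : D ⟶ A) : liftSieve f z t ↔
        (imageSubobject (Limits.Sigma.desc g)).Factors ((spec C).map t) := by
      rw [← hF, imageSubobject_mono, mk_factors_iff_exists]
      constructor
      · rintro ⟨w, hw⟩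
        exact ⟨pullback.lift w ((spec C).map t) hw, pullback.lift_snd _ _ _⟩
      · rintro ⟨w, hw⟩
        exact ⟨w ≫ pullback.fst f z, by rw [Category.assoc, pullback.condition, reassoc_of% hw]⟩
    intro D t ht
    rw [hlift] at ht
    let T := imageSubobject (Limits.Sigma.desc g)
    let g' (i : I) : Y i ⟶ T := Limits.Sigma.ι Y i ≫ factorThruImageSubobject (Limits.Sigma.desc g)
    have hg' (i) : g' i ≫ T.arrow = g i := by simp [g', T]
    have hd : Limits.Sigma.desc g' = factorThruImageSubobject (Limits.Sigma.desc g) := by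
      ext i : 1
      simp [g']
    have : Epi (Limits.Sigma.desc g') := by rw [hd]; infer_instance
    refine GrothendieckTopology.superset_covering _ ?_
      (jointlySurjective_of_epi g' (T.factorThru _ ht))
    rintro E s ⟨i, w, hw⟩
    obtain ⟨a, ha⟩ := (spec C).map_surjective (w ≫ (e i).inv)
    refine ⟨B i, a, b i, ⟨hb i, (hlift _).2 ?_⟩, (spec C).map_injective ?_⟩
    · refine (Subobject.factors_iff _ _).2 ?_
      rw [← hbe, ← hg' i, ← Category.assoc]
      exact (Subobject.factors_iff _ _).1 (Subobject.factors_comp_arrow _)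
    · have := hw =≫ T.arrow
      rw [Category.assoc, hg', Category.assoc, Subobject.factorThru_arrow] at this
      rw [Functor.map_comp, Functor.map_comp, ← this, ha, ← hbe]
      simp

lemma isZariskiOpen_iff {f : F ⟶ G} : IsZariskiOpen f ↔ IsOpenInclusion f :=
  ⟨isOpenInclusion_of_isZariskiOpen, IsOpenInclusion.isZariskiOpen⟩

end OpenInclusions

end RelSch

namespace RelSch

section Schemes

set_option linter.unusedSectionVars false

variable {C : Type u} [Category.{v} C] [MonoidalCategory C] [SymmetricCategory C]
  [MonoidalClosed C] [HasColimits C] [HasLimits C] {F G H : Sh C}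

/-- The sieve of the morphisms along which a section of `F` factors through an affine open. -/
def chartSieve {A : Aff C} (z : (spec C).obj A ⟶ F) : Sieve A where
  arrows B t := ∃ (U : Aff C) (p : (spec C).obj U ⟶ F) (w : (spec C).obj B ⟶ (spec C).obj U),
    IsOpenInclusion p ∧ w ≫ p = (spec C).map t ≫ z
  downward_closed := by
    rintro B D t ⟨U, p, w, hp, hw⟩ s
    exact ⟨U, p, (spec C).map s ≫ w, hp, by rw [Category.assoc, hw, Functor.map_comp, Category.assoc]⟩

lemma isScheme_iff : isScheme C F ↔
    ∀ ⦃A : Aff C⦄ (z : (spec C).obj A ⟶ F), chartSieve z ∈ zariskiTopology C A := by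
  constructor
  · rintro ⟨I, X, p, hp⟩ A z
    refine GrothendieckTopology.superset_covering _ ?_ ((jointlySurjective_iff_epi p).2 hp.epi z)
    rintro B t ⟨i, w, hw⟩
    obtain ⟨U, ⟨e⟩⟩ := (hp.isAffine i).exists_iso
    exact ⟨U, e.hom ≫ p i, w ≫ e.inv,
      (IsOpenInclusion.of_isIso e.hom).comp (isZariskiOpen_iff.1 (hp.isOpen i)), by simpa using hw⟩
  · intro h
    let I : Type (max u v) := Σ U : Aff C, {s : F.obj.obj (op U) // IsOpenInclusion (specEquiv.symm s)}
    refine ⟨I, fun i ↦ (spec C).obj i.1, fun i ↦ specEquiv.symm i.2.1, fun i ↦ isAffine_of_iso (Iso.refl _),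
      (jointlySurjective_iff_epi _).1 fun A z ↦ ?_, fun i ↦ isZariskiOpen_iff.2 i.2.2⟩
    refine GrothendieckTopology.superset_covering _ ?_ (h z)
    rintro B t ⟨U, p, w, hp, hw⟩
    exact ⟨⟨U, specEquiv p, by rwa [Equiv.symm_apply_apply]⟩, w, by
      dsimp only
      rw [Equiv.symm_apply_apply, hw]⟩

lemma isScheme_of_cover {I : Type*} {F : I → Sh C} {f : ∀ i, F i ⟶ G} (hf : JointlySurjective f)
    (ho : ∀ i, IsOpenInclusion (f i)) (hF : ∀ i, isScheme C (F i)) : isScheme C G := by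
  rw [isScheme_iff]
  intro A z
  refine GrothendieckTopology.transitive _ (hf z) _ ?_
  rintro B t ⟨i, w, hw⟩
  refine GrothendieckTopology.superset_covering _ ?_ (isScheme_iff.1 (hF i) w)
  rintro D s ⟨U, p, y, hp, hy⟩
  exact ⟨U, p ≫ f i, y, hp.comp (ho i), by
    rw [reassoc_of% hy, hw, Functor.map_comp, Category.assoc]⟩

section Coproduct

variable {I : Type (max u v)} (F : I → Sh C)

/-- The coproduct of sheaves, as presheaves. -/
def sigmaPresheaf : (Aff C)ᵒᵖ ⥤ Type (max u v) where
  obj A := Σ i, (F i).obj.obj A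
  map t := ↾fun x ↦ ⟨x.1, (F x.1).obj.map t x.2⟩
  map_id A := by
    refine ConcreteCategory.hom_ext _ _ fun ⟨i, x⟩ ↦ ?_
    exact congrArg (Sigma.mk i) congr($((F i).obj.map_id A) x)
  map_comp s t := by
    refine ConcreteCategory.hom_ext _ _ fun ⟨i, x⟩ ↦ ?_
    exact congrArg (Sigma.mk i) congr($((F i).obj.map_comp s t) x)

/-- The sheaf associated to a presheaf. -/
noncomputable def associatedSheaf (P : (Aff C)ᵒᵖ ⥤ Type (max u v)) : Sh C :=
  ⟨(zariskiTopology C).sheafify P, (zariskiTopology C).sheafify_isSheaf P⟩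

lemma exists_cover_of_toSheafify_eq (P : (Aff C)ᵒᵖ ⥤ Type (max u v)) {A : Aff C} {a b : P.obj (op A)}
    (h : ((zariskiTopology C).toSheafify P).app _ a = ((zariskiTopology C).toSheafify P).app _ b) :
    ∃ S ∈ zariskiTopology C A, ∀ ⦃B : Aff C⦄ (t : B ⟶ A), S t → P.map t.op a = P.map t.op b :=
  ⟨Presheaf.equalizerSieve (F := P) a b,
    Presheaf.equalizerSieve_mem (zariskiTopology C) ((zariskiTopology C).toSheafify P) a b h,
    fun _ _ ht ↦ ht⟩

/-- The inclusions in the sheaf associated to `sigmaPresheaf`. -/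
noncomputable def sigmaInclusion (i : I) : F i ⟶ associatedSheaf (sigmaPresheaf F) :=
  ⟨{ app A := ↾fun x ↦ (⟨i, x⟩ : (sigmaPresheaf F).obj A) } ≫ (zariskiTopology C).toSheafify _⟩

lemma exists_cover_of_comp_sigma_eq {i j : I} {A : Aff C} {x : (spec C).obj A ⟶ F i}
    {y : (spec C).obj A ⟶ F j} (h : x ≫ Limits.Sigma.ι F i = y ≫ Limits.Sigma.ι F j) :
    ∃ S ∈ zariskiTopology C A, ∀ ⦃B : Aff C⦄ (t : B ⟶ A), S t →
      (⟨i, (spec C).map t ≫ x⟩ : Σ i, (spec C).obj B ⟶ F i) = ⟨j, (spec C).map t ≫ y⟩ := by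
  have h' : x ≫ sigmaInclusion F i = y ≫ sigmaInclusion F j := by
    simpa using h =≫ Limits.Sigma.desc (sigmaInclusion F)
  obtain ⟨S, hS, hS'⟩ := exists_cover_of_toSheafify_eq (sigmaPresheaf F) (A := A)
    (a := ⟨i, specEquiv x⟩) (b := ⟨j, specEquiv y⟩) congr(specEquiv $h')
  refine ⟨S, hS, fun B t ht ↦ ?_⟩
  have e : (⟨i, specEquiv ((spec C).map t ≫ x)⟩ : Σ i, (F i).obj.obj (op B)) =
      ⟨j, specEquiv ((spec C).map t ≫ y)⟩ := by
    rw [specEquiv_map, specEquiv_map]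
    exact hS' t ht
  have e' := congrArg (fun s : Σ i, (F i).obj.obj (op B) ↦
    (⟨s.1, specEquiv.symm s.2⟩ : Σ i, (spec C).obj B ⟶ F i)) e
  simpa only [Equiv.symm_apply_apply] using e'

lemma jointlySurjective_sigma_ι : JointlySurjective (Limits.Sigma.ι F) := by
  rw [jointlySurjective_iff_epi]
  have : Limits.Sigma.desc (Limits.Sigma.ι F) = 𝟙 _ := by ext i : 1; simp
  rw [this]
  infer_instance

lemma isOpenInclusion_sigma_ι (i : I) : IsOpenInclusion (Limits.Sigma.ι F i) where
  mono := mono_of_spec fun A x y hxy ↦ by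
    obtain ⟨S, hS, h⟩ := exists_cover_of_comp_sigma_eq F hxy
    exact spec_hom_ext hS fun B t ht ↦ by simpa using h t ht
  isOpenSieve A z := by
    refine isOpenSieve_of_cover (jointlySurjective_sigma_ι F z) ?_
    rintro B t ⟨j, w, hw⟩
    rw [liftSieve_pullback, ← hw]
    by_cases hij : i = j
    · subst hij
      have : liftSieve (Limits.Sigma.ι F i) (w ≫ Limits.Sigma.ι F i) = ⊤ := by
        ext D s
        exact ⟨fun _ ↦ trivial, fun _ ↦ ⟨(spec C).map s ≫ w, Category.assoc _ _ _⟩⟩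
      rw [this]
      exact isOpenSieve_top
    · refine isOpenSieve_of_bot_mem ?_
      rintro D s ⟨x, hx⟩
      obtain ⟨S, hS, h⟩ := exists_cover_of_comp_sigma_eq F (hx.trans (Category.assoc _ _ _).symm)
      exact GrothendieckTopology.superset_covering _
        (fun E r hr ↦ (hij congr(Sigma.fst $(h r hr))).elim) hS

theorem isScheme_sigma (hF : ∀ i, isScheme C (F i)) : isScheme C (∐ F) :=
  isScheme_of_cover (jointlySurjective_sigma_ι F) (isOpenInclusion_sigma_ι F) hF

end Coproduct

lemma IsAffineOpen.isOpenInclusion {U V : Aff C} {c : V ⟶ U} (hc : IsAffineOpen c) :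
    IsOpenInclusion ((spec C).map c) where
  mono := mono_of_spec fun A x y hxy ↦ by
    have := hc.mono
    obtain ⟨x, rfl⟩ := (spec C).map_surjective x
    obtain ⟨y, rfl⟩ := (spec C).map_surjective y
    rw [← Functor.map_comp, ← Functor.map_comp] at hxy
    rw [(cancel_mono c).1 ((spec C).map_injective hxy)]
  isOpenSieve A z := by
    obtain ⟨z, rfl⟩ := (spec C).map_surjective z
    rintro B t ⟨w, hw⟩
    obtain ⟨w, rfl⟩ := (spec C).map_surjective w
    rw [← Functor.map_comp, ← Functor.map_comp] at hw
    refine GrothendieckTopology.superset_covering _ ?_ (GrothendieckTopology.top_mem _ B)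
    intro D s _
    have hw' : (s ≫ w) ≫ c = (s ≫ t) ≫ z := by
      rw [Category.assoc, (spec C).map_injective hw, Category.assoc]
    refine ⟨pullback c z, pullback.lift (s ≫ w) (s ≫ t) hw', pullback.snd c z,
      ⟨hc.of_isPullback (IsPullback.of_hasPullback c z), (spec C).map (pullback.fst c z), ?_⟩,
      pullback.lift_snd _ _ _⟩
    rw [← Functor.map_comp, ← Functor.map_comp, pullback.condition]

section FibreProduct

variable {f : F ⟶ H} {g : G ⟶ H}

/-- Sections of a scheme over `H` factor locally through affine opens lying over a given open. -/
lemma exists_chart_over (f : F ⟶ H) {K U : Aff C} {q : (spec C).obj K ⟶ H} (hq : IsOpenInclusion q)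
    {p : (spec C).obj U ⟶ F} (hp : IsOpenInclusion p) {A : Aff C} (w : (spec C).obj A ⟶ (spec C).obj U)
    (y : (spec C).obj A ⟶ (spec C).obj K) (h : w ≫ p ≫ f = y ≫ q) :
    ∃ S ∈ zariskiTopology C A, ∀ ⦃B : Aff C⦄ (t : B ⟶ A), S t →
      ∃ (V : Aff C) (p' : (spec C).obj V ⟶ F) (k : V ⟶ K) (b : B ⟶ V), IsOpenInclusion p' ∧
        p' ≫ f = (spec C).map k ≫ q ∧ (spec C).map b ≫ p' = (spec C).map t ≫ w ≫ p := by
  obtain ⟨w, rfl⟩ := (spec C).map_surjective w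
  refine ⟨_, hq.isOpenSieve (p ≫ f) w ⟨y, h.symm⟩, ?_⟩
  rintro B t ⟨V, b, c, ⟨hc, k, hk⟩, hbc⟩
  obtain ⟨k, rfl⟩ := (spec C).map_surjective k
  refine ⟨V, (spec C).map c ≫ p, k, b, ?_, ?_, ?_⟩
  · exact hc.isOpenInclusion.comp hp
  · rw [hk, Category.assoc]
  · rw [← Functor.map_comp_assoc, hbc, Functor.map_comp, Category.assoc]

lemma isOpenInclusion_of_isPullback {V W K P : Aff C} {k : V ⟶ K} {l : W ⟶ K} {a : P ⟶ V} {b : P ⟶ W}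
    (sq : IsPullback a b k l) {q : (spec C).obj K ⟶ H} (hq : Mono q)
    {x : (spec C).obj V ⟶ F} {y : (spec C).obj W ⟶ G} (hx : IsOpenInclusion x) (hy : IsOpenInclusion y)
    (hxk : x ≫ f = (spec C).map k ≫ q) (hyl : y ≫ g = (spec C).map l ≫ q)
    {m : (spec C).obj P ⟶ pullback f g} (h₁ : m ≫ pullback.fst f g = (spec C).map a ≫ x)
    (h₂ : m ≫ pullback.snd f g = (spec C).map b ≫ y) : IsOpenInclusion m where
  mono := mono_of_spec fun A r s hrs ↦ by
    obtain ⟨r, rfl⟩ := (spec C).map_surjective r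
    obtain ⟨s, rfl⟩ := (spec C).map_surjective s
    have := hx.mono
    have := hy.mono
    congr 1
    refine sq.hom_ext ((spec C).map_injective ?_) ((spec C).map_injective ?_)
    · rw [← cancel_mono x, Functor.map_comp, Functor.map_comp, Category.assoc, Category.assoc, ← h₁,
        reassoc_of% hrs]
    · rw [← cancel_mono y, Functor.map_comp, Functor.map_comp, Category.assoc, Category.assoc, ← h₂,
        reassoc_of% hrs]
  isOpenSieve A z := by
    have : liftSieve m z =
        liftSieve x (z ≫ pullback.fst f g) ⊓ liftSieve y (z ≫ pullback.snd f g) := by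
      ext B t
      constructor
      · rintro ⟨w, hw⟩
        refine ⟨⟨w ≫ (spec C).map a, ?_⟩, ⟨w ≫ (spec C).map b, ?_⟩⟩
        · rw [Category.assoc, ← h₁, reassoc_of% hw]
        · rw [Category.assoc, ← h₂, reassoc_of% hw]
      · rintro ⟨⟨r, hr⟩, ⟨s, hs⟩⟩
        obtain ⟨r, rfl⟩ := (spec C).map_surjective r
        obtain ⟨s, rfl⟩ := (spec C).map_surjective s
        have e : r ≫ k = s ≫ l := (spec C).map_injective (by
          rw [← cancel_mono q, Functor.map_comp, Functor.map_comp, Category.assoc, Category.assoc,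
            ← hxk, ← hyl, reassoc_of% hr, reassoc_of% hs, pullback.condition])
        refine ⟨(spec C).map (sq.lift r s e), ?_⟩
        apply pullback.hom_ext
        · rw [Category.assoc, h₁, ← Functor.map_comp_assoc, sq.lift_fst, hr, Category.assoc]
        · rw [Category.assoc, h₂, ← Functor.map_comp_assoc, sq.lift_snd, hs, Category.assoc]
    rw [this]
    exact (hx.isOpenSieve _).inf (hy.isOpenSieve _)

theorem isScheme_pullback (hF : isScheme C F) (hG : isScheme C G) (hH : isScheme C H) :
    isScheme C (pullback f g) := by
  rw [isScheme_iff] at hF hG hH ⊢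
  intro A z
  refine GrothendieckTopology.transitive _ (GrothendieckTopology.intersection_covering _
    (GrothendieckTopology.intersection_covering _ (hF (z ≫ pullback.fst f g))
      (hG (z ≫ pullback.snd f g))) (hH (z ≫ pullback.fst f g ≫ f))) _ ?_
  rintro B t ⟨⟨⟨U, p, w, hp, hw⟩, ⟨U', p', w', hp', hw'⟩⟩, ⟨K, q, y, hq, hy⟩⟩
  obtain ⟨S, hS, h⟩ := exists_chart_over f hq hp w y (by rw [reassoc_of% hw, hy])
  obtain ⟨S', hS', h'⟩ := exists_chart_over g hq hp' w' y (by
    rw [reassoc_of% hw', hy, pullback.condition])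
  refine GrothendieckTopology.superset_covering _ ?_
    (GrothendieckTopology.intersection_covering _ hS hS')
  rintro D s ⟨hs, hs'⟩
  obtain ⟨V, x, k, b, hx, hxk, hb⟩ := h s hs
  obtain ⟨W, y', l, b', hy', hyl, hb'⟩ := h' s hs'
  have := hq.mono
  have sq := IsPullback.of_hasPullback k l
  have e : b ≫ k = b' ≫ l := (spec C).map_injective (by
    rw [← cancel_mono q, Functor.map_comp, Functor.map_comp, Category.assoc, Category.assoc,
      ← hxk, ← hyl, reassoc_of% hb, reassoc_of% hb', reassoc_of% hw, reassoc_of% hw',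
      pullback.condition])
  let m : (spec C).obj (pullback k l) ⟶ pullback f g :=
    pullback.lift ((spec C).map (pullback.fst k l) ≫ x) ((spec C).map (pullback.snd k l) ≫ y') (by
      rw [Category.assoc, Category.assoc, hxk, hyl, ← Functor.map_comp_assoc,
        ← Functor.map_comp_assoc, pullback.condition])
  have hm₁ : m ≫ pullback.fst f g = (spec C).map (pullback.fst k l) ≫ x := pullback.lift_fst _ _ _
  have hm₂ : m ≫ pullback.snd f g = (spec C).map (pullback.snd k l) ≫ y' := pullback.lift_snd _ _ _
  refine ⟨_, m, (spec C).map (pullback.lift b b' e),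
    isOpenInclusion_of_isPullback sq this hx hy' hxk hyl hm₁ hm₂, ?_⟩
  apply pullback.hom_ext
  · rw [Category.assoc, hm₁, ← Functor.map_comp_assoc, pullback.lift_fst, hb, hw]
    simp
  · rw [Category.assoc, hm₂, ← Functor.map_comp_assoc, pullback.lift_snd, hb', hw']
    simp

end FibreProduct

end Schemes

end RelSch

namespace RelSch

section Relations

universe v₁ u₁

variable {𝒜 : Type u₁} [Category.{v₁} 𝒜]

lemma factors_iff_exists {X T : 𝒜} (P : Subobject X) (h : T ⟶ X) :
    P.Factors h ↔ ∃ w : T ⟶ P, w ≫ P.arrow = h :=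
  ⟨fun hw ↦ ⟨P.factorThru h hw, Subobject.factorThru_arrow _ _ _⟩, by
    rintro ⟨w, rfl⟩
    exact Subobject.factors_comp_arrow w⟩

lemma subobject_ext {X : 𝒜} {P Q : Subobject X} (h : ∀ ⦃T : 𝒜⦄ (k : T ⟶ X), P.Factors k ↔ Q.Factors k) :
    P = Q :=
  le_antisymm (Subobject.le_of_factors ((h _).1 (Subobject.factors_self P)))
    (Subobject.le_of_factors ((h _).2 (Subobject.factors_self Q)))

lemma pullback_factors_iff [HasPullbacks 𝒜] {X Y T : 𝒜} (g : X ⟶ Y) (P : Subobject Y) (h : T ⟶ X) :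
    ((Subobject.pullback g).obj P).Factors h ↔ P.Factors (h ≫ g) := by
  rw [factors_iff_exists, factors_iff_exists]
  have sq := Subobject.isPullback g P
  constructor
  · rintro ⟨w, rfl⟩
    exact ⟨w ≫ Subobject.pullbackπ g P, by rw [Category.assoc, Category.assoc, sq.w]⟩
  · rintro ⟨w, hw⟩
    exact ⟨sq.lift w h hw, sq.lift_snd _ _ _⟩

lemma mk_prod_lift_factors_iff [HasBinaryProducts 𝒜] {X Q K T : 𝒜} {π : X ⟶ Q} {a b : K ⟶ X}
    (hk : IsKernelPair π a b) [Mono (prod.lift a b)] (x y : T ⟶ X) :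
    (Subobject.mk (prod.lift a b)).Factors (prod.lift x y) ↔ x ≫ π = y ≫ π := by
  rw [mk_factors_iff_exists]
  constructor
  · rintro ⟨w, hw⟩
    have h1 : w ≫ a = x := by
      have := hw =≫ prod.fst
      rwa [prod.lift_fst, Category.assoc, prod.lift_fst] at this
    have h2 : w ≫ b = y := by
      have := hw =≫ prod.snd
      rwa [prod.lift_snd, Category.assoc, prod.lift_snd] at this
    rw [← h1, ← h2, Category.assoc, hk.w, Category.assoc]
  · intro h
    exact ⟨hk.lift x y h, by rw [prod.comp_lift, hk.lift_fst, hk.lift_snd]⟩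

lemma prod_lift_fst_snd [HasBinaryProducts 𝒜] {X Y T : 𝒜} (k : T ⟶ X ⨯ Y) :
    prod.lift (k ≫ prod.fst) (k ≫ prod.snd) = k :=
  Limits.prod.hom_ext (prod.lift_fst _ _) (prod.lift_snd _ _)

lemma isKernelPair_mk_prod_lift [HasBinaryProducts 𝒜] {X Q K : 𝒜} {π : X ⟶ Q} {a b : K ⟶ X}
    (hk : IsKernelPair π a b) [Mono (prod.lift a b)] :
    IsKernelPair π ((Subobject.mk (prod.lift a b)).arrow ≫ prod.fst)
      ((Subobject.mk (prod.lift a b)).arrow ≫ prod.snd) :=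
  IsPullback.of_iso hk (Subobject.underlyingIso _).symm (Iso.refl _) (Iso.refl _) (Iso.refl _)
    (by simp [prod.lift_fst]) (by simp [prod.lift_snd]) (by simp) (by simp)

end Relations

section Quotients

set_option linter.unusedSectionVars false

variable {C : Type u} [Category.{v} C] [MonoidalCategory C] [SymmetricCategory C]
  [MonoidalClosed C] [HasColimits C] [HasLimits C] {F G H : Sh C}

lemma exists_lift_of_liftSieve_mem {f : F ⟶ G} [Mono f] {A : Aff C} {z : (spec C).obj A ⟶ G}
    (h : liftSieve f z ∈ zariskiTopology C A) : ∃ w : (spec C).obj A ⟶ F, w ≫ f = z := by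
  have hs : JointlySurjective (fun _ : PUnit.{1} ↦ pullback.snd f z) := by
    intro B y
    obtain ⟨y, rfl⟩ := (spec C).map_surjective y
    refine GrothendieckTopology.superset_covering _ ?_ (GrothendieckTopology.pullback_stable _ y h)
    rintro D t ⟨w, hw⟩
    exact ⟨⟨⟩, pullback.lift w ((spec C).map (t ≫ y)) hw, by
      rw [pullback.lift_snd, Functor.map_comp]⟩
  have : Epi (pullback.snd f z) := ⟨fun a b hab ↦ hs.hom_ext fun _ ↦ hab⟩
  have : IsIso (pullback.snd f z) := isIso_of_mono_of_epi _
  exact ⟨inv (pullback.snd f z) ≫ pullback.fst f z, by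
    rw [Category.assoc, pullback.condition, IsIso.inv_hom_id_assoc]⟩

section Effective

variable {K X : Sh C} {a b : K ⟶ X}

/-- The equivalence relation on sections defined by a pair of morphisms. -/
def sectionRel (a b : K ⟶ X) (A : Aff C) (x y : (spec C).obj A ⟶ X) : Prop :=
  ∃ w : (spec C).obj A ⟶ K, w ≫ a = x ∧ w ≫ b = y

lemma equivalence_sectionRel (h : IsEquivalenceRelation a b) (A : Aff C) :
    Equivalence (sectionRel a b A) := by
  obtain ⟨⟨e⟩⟩ := h
  refine ⟨fun x ↦ ⟨x ≫ e.r, by simp, by simp⟩, ?_, ?_⟩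
  · rintro _ _ ⟨w, rfl, rfl⟩
    exact ⟨w ≫ e.s, by rw [Category.assoc, e.symmetry₁], by rw [Category.assoc, e.symmetry₂]⟩
  · rintro _ y _ ⟨w, rfl, h⟩ ⟨w', h', rfl⟩
    refine ⟨PullbackCone.IsLimit.lift e.isLimit w w' (h.trans h'.symm) ≫ e.t, ?_, ?_⟩
    · rw [Category.assoc, e.transitivity₁, PullbackCone.IsLimit.lift_fst_assoc]
    · rw [Category.assoc, e.transitivity₂, PullbackCone.IsLimit.lift_snd_assoc]

lemma sectionRel.map {A B : Aff C} (t : B ⟶ A) {x y : (spec C).obj A ⟶ X} (h : sectionRel a b A x y) :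
    sectionRel a b B ((spec C).map t ≫ x) ((spec C).map t ≫ y) := by
  obtain ⟨w, rfl, rfl⟩ := h
  exact ⟨(spec C).map t ≫ w, Category.assoc _ _ _, Category.assoc _ _ _⟩

/-- The quotient of a sheaf by a relation, as a presheaf. -/
noncomputable def quotientPresheaf (a b : K ⟶ X) : (Aff C)ᵒᵖ ⥤ Type (max u v) where
  obj A := Quot (sectionRel a b A.unop)
  map t := ↾(Quot.map ((spec C).map t.unop ≫ ·) fun _ _ h ↦ h.map t.unop)
  map_id A := ConcreteCategory.hom_ext _ _ fun x ↦ by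
    induction x using Quot.ind with | mk x =>
    exact congrArg (Quot.mk _) (by simp)
  map_comp s t := ConcreteCategory.hom_ext _ _ fun x ↦ by
    induction x using Quot.ind with | mk x =>
    exact congrArg (Quot.mk _) (by simp)

/-- The projection to the sheaf associated to `quotientPresheaf`. -/
noncomputable def quotientProjection (a b : K ⟶ X) : X ⟶ associatedSheaf (quotientPresheaf a b) :=
  ⟨{ app A := ↾fun x ↦ (Quot.mk _ (specEquiv (A := A.unop).symm x) : (quotientPresheaf a b).obj A)
     naturality A B t := ConcreteCategory.hom_ext _ _ fun x ↦
      congrArg (Quot.mk (sectionRel a b B.unop)) (specEquiv.injective (by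
        rw [specEquiv_map, Equiv.apply_symm_apply, Equiv.apply_symm_apply]
        rfl)) } ≫
    (zariskiTopology C).toSheafify _⟩

lemma comp_quotientProjection {A : Aff C} (x : (spec C).obj A ⟶ X) :
    specEquiv (x ≫ quotientProjection a b) = ((zariskiTopology C).toSheafify
      (quotientPresheaf a b)).app (op A) (Quot.mk _ x) := by
  rw [specEquiv_comp]
  change ((zariskiTopology C).toSheafify (quotientPresheaf a b)).app (op A)
    (Quot.mk _ (specEquiv.symm (specEquiv x))) = _
  rw [Equiv.symm_apply_apply]

lemma quotientProjection_condition : a ≫ quotientProjection a b = b ≫ quotientProjection a b :=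
  hom_ext_spec fun A w ↦ specEquiv.injective (by
    rw [← Category.assoc, ← Category.assoc, comp_quotientProjection, comp_quotientProjection]
    exact congrArg _ (Quot.sound ⟨w, rfl, rfl⟩))

lemma exists_cover_of_comp_coequalizer_eq (h : IsEquivalenceRelation a b) {A : Aff C}
    {x y : (spec C).obj A ⟶ X} (hxy : x ≫ coequalizer.π a b = y ≫ coequalizer.π a b) :
    ∃ S ∈ zariskiTopology C A, ∀ ⦃B : Aff C⦄ (t : B ⟶ A), S t →
      sectionRel a b B ((spec C).map t ≫ x) ((spec C).map t ≫ y) := by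
  have h' : x ≫ quotientProjection a b = y ≫ quotientProjection a b := by
    have := hxy =≫ coequalizer.desc _ quotientProjection_condition
    simpa using this
  have h'' := congr(specEquiv $h')
  rw [comp_quotientProjection, comp_quotientProjection] at h''
  obtain ⟨S, hS, hS'⟩ := exists_cover_of_toSheafify_eq _ h''
  exact ⟨S, hS, fun B t ht ↦ (equivalence_sectionRel h B).quot_mk_eq_iff _ _ |>.1 (hS' t ht)⟩

lemma prod_lift_factors_iff {R : Subobject (X ⨯ X)}
    (h : IsEquivalenceRelation (R.arrow ≫ prod.fst) (R.arrow ≫ prod.snd)) {A : Aff C}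
    (x y : (spec C).obj A ⟶ X) : R.Factors (prod.lift x y) ↔
      x ≫ coequalizer.π (R.arrow ≫ prod.fst) (R.arrow ≫ prod.snd) =
        y ≫ coequalizer.π (R.arrow ≫ prod.fst) (R.arrow ≫ prod.snd) := by
  rw [factors_iff_exists]
  constructor
  · rintro ⟨w, hw⟩
    have h1 : w ≫ R.arrow ≫ prod.fst = x := by rw [reassoc_of% hw, prod.lift_fst]
    have h2 : w ≫ R.arrow ≫ prod.snd = y := by rw [reassoc_of% hw, prod.lift_snd]
    rw [← h1, ← h2, Category.assoc w, coequalizer.condition, Category.assoc w]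
  · intro hxy
    obtain ⟨S, hS, hS'⟩ := exists_cover_of_comp_coequalizer_eq h hxy
    refine exists_lift_of_liftSieve_mem (GrothendieckTopology.superset_covering _ ?_ hS)
    intro B t ht
    obtain ⟨w, hw, hw'⟩ := hS' t ht
    refine ⟨w, Limits.prod.hom_ext ?_ ?_⟩
    · rw [Category.assoc, hw, Category.assoc, prod.lift_fst]
    · rw [Category.assoc, hw', Category.assoc, prod.lift_snd]

end Effective

section Gluing

variable {X : Sh C} {R : Subobject (X ⨯ X)} {I : Type (max u v)} {U : I → Sh C} {u : ∀ i, U i ⟶ X}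
  {Q : Sh C} {π : X ⟶ Q}

lemma restrictRelation_factors_iff (i j : I) {T : Sh C} (x : T ⟶ U i) (y : T ⟶ U j) :
    (restrictRelation R u i j).Factors (prod.lift x y) ↔ R.Factors (prod.lift (x ≫ u i) (y ≫ u j)) := by
  rw [restrictRelation, pullback_factors_iff, prod.lift_map]

/-- Lifts along the projection `R i j ⟶ U i`. -/
lemma exists_restrictRelation_lift_iff
    (hR : ∀ ⦃A : Aff C⦄ (x y : (spec C).obj A ⟶ X), R.Factors (prod.lift x y) ↔ x ≫ π = y ≫ π)
    (i j : I) {A : Aff C} (z : (spec C).obj A ⟶ U i) :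
    (∃ w : (spec C).obj A ⟶ (restrictRelation R u i j : Sh C),
      w ≫ (restrictRelation R u i j).arrow ≫ prod.fst = z) ↔
      ∃ y : (spec C).obj A ⟶ U j, y ≫ u j ≫ π = z ≫ u i ≫ π := by
  constructor
  · rintro ⟨w, rfl⟩
    refine ⟨w ≫ (restrictRelation R u i j).arrow ≫ prod.snd, ?_⟩
    have h : (restrictRelation R u i j).Factors
        (prod.lift (w ≫ (restrictRelation R u i j).arrow ≫ prod.fst)
          (w ≫ (restrictRelation R u i j).arrow ≫ prod.snd)) := by
      rw [factors_iff_exists]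
      exact ⟨w, by simpa only [Category.assoc] using (prod_lift_fst_snd (w ≫ _)).symm⟩
    rw [restrictRelation_factors_iff, hR] at h
    simpa using h.symm
  · rintro ⟨y, hy⟩
    have h : (restrictRelation R u i j).Factors (prod.lift z y) := by
      rw [restrictRelation_factors_iff, hR, Category.assoc, Category.assoc, hy]
    obtain ⟨w, hw⟩ := (factors_iff_exists _ _).1 h
    exact ⟨w, by rw [reassoc_of% hw, prod.lift_fst]⟩

theorem isScheme_quotient {e : ∐ U ≅ X} (h : IsGluingRelation R U e) : isScheme C (quotient R) := by
  let u (k : I) : U k ⟶ X := Limits.Sigma.ι U k ≫ e.hom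
  let π : X ⟶ quotient R := coequalizer.π _ _
  have hR ⦃A : Aff C⦄ (x y : (spec C).obj A ⟶ X) : R.Factors (prod.lift x y) ↔ x ≫ π = y ≫ π :=
    prod_lift_factors_iff h.equivalence x y
  have hπ : Epi π := inferInstanceAs (Epi (coequalizer.π _ _))
  have hd : Limits.Sigma.desc (fun k ↦ u k ≫ π) = e.hom ≫ π := by
    ext k : 1
    simp [u]
  have hepi : Epi (Limits.Sigma.desc (fun k ↦ u k ≫ π)) := by
    rw [hd]
    infer_instance
  have hs := (jointlySurjective_iff_epi _).2 hepi
  have ho (i : I) : IsOpenInclusion (u i ≫ π) :=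
    { mono := mono_of_spec fun A x y hxy ↦ by
        have hf : (restrictRelation R u i i).Factors (prod.lift x y) := by
          rw [restrictRelation_factors_iff, hR, Category.assoc x, Category.assoc y, hxy]
        rw [h.diagonal i, imageSubobject_mono, mk_factors_iff_exists] at hf
        obtain ⟨w, hw⟩ := hf
        have h1 := hw =≫ prod.fst
        have h2 := hw =≫ prod.snd
        rw [prod.lift_fst, Category.assoc, prod.lift_fst, Category.comp_id] at h1
        rw [prod.lift_snd, Category.assoc, prod.lift_snd, Category.comp_id] at h2
        rw [← h1, ← h2]
      isOpenSieve := fun A z ↦ by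
        refine isOpenSieve_of_cover (hs z) ?_
        rintro B t ⟨j, w, hw⟩
        have : (liftSieve (u i ≫ π) z).pullback t =
            liftSieve ((restrictRelation R u j i).arrow ≫ prod.fst) w := by
          rw [liftSieve_pullback, ← hw]
          ext D s
          refine Iff.trans ?_ (exists_restrictRelation_lift_iff hR j i ((spec C).map s ≫ w)).symm
          rw [Category.assoc]
          rfl
        rw [this]
        exact (isZariskiOpen_iff.1 (h.isOpen j i)).isOpenSieve w }
  exact ⟨I, U, fun k ↦ u k ≫ π, h.isAffine, hepi, fun i ↦ isZariskiOpen_iff.2 (ho i)⟩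

theorem exists_isGluingRelation (hF : isScheme C F) :
    ∃ (X : Sh C) (R : Subobject (X ⨯ X)) (I : Type (max u v)) (U : I → Sh C) (e : ∐ U ≅ X),
      IsGluingRelation R U e ∧ Nonempty (F ≅ quotient R) := by
  obtain ⟨I, U, p, hp⟩ := hF
  let π : ∐ U ⟶ F := Limits.Sigma.desc p
  have : Epi π := hp.epi
  have hk := IsPullback.of_hasPullback π π
  have hm : Mono (prod.lift (pullback.fst π π) (pullback.snd π π)) :=
    ⟨fun a b hab ↦ pullback.hom_ext
      (by simpa only [Category.assoc, prod.lift_fst] using hab =≫ prod.fst)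
      (by simpa only [Category.assoc, prod.lift_snd] using hab =≫ prod.snd)⟩
  let R := Subobject.mk (prod.lift (pullback.fst π π) (pullback.snd π π))
  have hk' : IsKernelPair π (R.arrow ≫ prod.fst) (R.arrow ≫ prod.snd) := isKernelPair_mk_prod_lift hk
  let u (k : I) : U k ⟶ ∐ U := Limits.Sigma.ι U k ≫ (Iso.refl (∐ U)).hom
  have hu (k : I) : u k ≫ π = p k := by simp [u, π]
  have hR {T : Sh C} (x y : T ⟶ ∐ U) : R.Factors (prod.lift x y) ↔ x ≫ π = y ≫ π :=
    mk_prod_lift_factors_iff hk x y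
  have ho (i : I) := isZariskiOpen_iff.1 (hp.isOpen i)
  have hmono (i : I) : Mono (p i) := (ho i).mono
  refine ⟨∐ U, R, I, U, Iso.refl _, ⟨?_, hp.isAffine, fun i j ↦ ?_, fun i ↦ ?_⟩, ?_⟩
  · exact (IsKernelPair.equivalenceRelation π _ _ (pullback.isLimit _ _) hk').isEquivalenceRelation
  · refine isZariskiOpen_iff.2 ((ho j).of_lift_iff (p i) (mono_of_spec fun A x y hxy ↦ ?_) ?_)
    · rw [← cancel_mono (restrictRelation R u i j).arrow]
      have key (x : (spec C).obj A ⟶ (restrictRelation R u i j : Sh C)) :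
          x ≫ (restrictRelation R u i j).arrow ≫ prod.fst ≫ p i =
            x ≫ (restrictRelation R u i j).arrow ≫ prod.snd ≫ p j := by
        have h := Subobject.factors_comp_arrow (P := restrictRelation R u i j) x
        have e : x ≫ (restrictRelation R u i j).arrow =
            prod.lift (x ≫ (restrictRelation R u i j).arrow ≫ prod.fst)
              (x ≫ (restrictRelation R u i j).arrow ≫ prod.snd) :=
          by simpa only [Category.assoc] using (prod_lift_fst_snd (x ≫ _)).symm
        rw [e, restrictRelation_factors_iff, hR] at h
        simpa [hu] using h
      apply Limits.prod.hom_ext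
      · rw [Category.assoc, Category.assoc]
        exact hxy
      · rw [← cancel_mono (p j), Category.assoc, Category.assoc, Category.assoc, Category.assoc, ← key,
          ← key]
        have := hxy =≫ p i
        simpa only [Category.assoc] using this
    · intro A z
      have := exists_restrictRelation_lift_iff (u := u) (fun A x y ↦ hR x y) i j z
      rwa [hu, hu] at this
  · rw [imageSubobject_mono]
    refine subobject_ext fun T k ↦ ?_
    obtain ⟨x, y, rfl⟩ : ∃ x y, k = prod.lift x y :=
      ⟨_, _, (prod_lift_fst_snd k).symm⟩
    refine (restrictRelation_factors_iff (u := u) i i x y).trans ((hR _ _).trans ?_)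
    rw [Category.assoc x, Category.assoc y, hu, cancel_mono, mk_factors_iff_exists]
    constructor
    · rintro rfl
      exact ⟨x, by rw [prod.comp_lift, Category.comp_id]⟩
    · rintro ⟨w, hw⟩
      have h1 := hw =≫ prod.fst
      have h2 := hw =≫ prod.snd
      rw [prod.lift_fst, Category.assoc, prod.lift_fst, Category.comp_id] at h1
      rw [prod.lift_snd, Category.assoc, prod.lift_snd, Category.comp_id] at h2
      rw [← h1, ← h2]
  · have : IsRegularEpi π := IsRegularEpiCategory.regularEpiOfEpi π
    exact ⟨IsColimit.coconePointUniqueUpToIso hk'.toCoequalizer' (colimit.isColimit _)⟩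

lemma isScheme_of_iso (e : F ≅ G) (hG : isScheme C G) : isScheme C F := by
  rw [isScheme_iff] at hG ⊢
  intro A z
  refine GrothendieckTopology.superset_covering _ ?_ (hG (z ≫ e.hom))
  rintro B t ⟨V, p, w, hp, hw⟩
  exact ⟨V, p ≫ e.inv, w, hp.comp (.of_isIso e.inv), by rw [reassoc_of% hw]; simp⟩

end Gluing

end Quotients

end RelSch

theorem mainTheorem3 (C : Type u) [Category.{v} C] [MonoidalCategory C] [SymmetricCategory C]
    [MonoidalClosed C] [HasLimits C] [HasColimits C] :
    (∀ (I : Type (max u v)) (F : I → RelSch.Sh C),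
      (∀ i, RelSch.isScheme C (F i)) → RelSch.isScheme C (∐ F)) ∧
    (∀ (F G H : RelSch.Sh C) (f : F ⟶ H) (g : G ⟶ H), RelSch.isScheme C F →
      RelSch.isScheme C G → RelSch.isScheme C H → RelSch.isScheme C (pullback f g)) ∧
    (∀ F : RelSch.Sh C, RelSch.isScheme C F ↔
      ∃ (X : RelSch.Sh C) (R : Subobject (X ⨯ X)) (I : Type (max u v)) (U : I → RelSch.Sh C)
        (e : ∐ U ≅ X), RelSch.IsGluingRelation R U e ∧ Nonempty (F ≅ RelSch.quotient R)) := by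
  refine ⟨fun I F hF ↦ RelSch.isScheme_sigma F hF,
    fun F G H f g hF hG hH ↦ RelSch.isScheme_pullback hF hG hH,
    fun F ↦ ⟨RelSch.exists_isGluingRelation, ?_⟩⟩
  rintro ⟨X, R, I, U, e, h, ⟨i⟩⟩
  exact RelSch.isScheme_of_iso i (RelSch.isScheme_quotient h)
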